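/- Let $\mathcal T=(V,E)$ be a directed tree, i.e. a connected directed graph without loops and circuits in which every vertex $v$ has at most one parent $\mathrm{Par}(v)$; a root is a vertex without a parent. Let $\mathrm{Chi}(u)$ be the set of children of $u$, $\mathrm{Chi}^n(u)$ the set of its $n$-th generation descendants, and $\mathrm{Gen}(u)$ the level of $u$ (all $v$ that have a common $j$-th ancestor with $u$ for some $j\ge 0$). Let $\lambda_v>0$ be weights ($v\in V$ not a root) with $\sup_u\sum_{v\in\mathrm{Chi}(u)}\lambda_v^2<\infty$, and let $S_\lambda$ be the bounded operator on $\ell^2(V)$ with $S_\lambda e_u=\sum_{v\in \mathrm{Chi}(u)}\lambda_v e_v$. Assume that $S_\lambda$ is a contraction and is not stable, i.e. the stable subspace $\mathcal H_0=\{h:\ \|S_\lambda^n h\|\to 0\}$ is not all of $\ell^2(V)$. Let $A=\lim_n S_\lambda^{*n}S_\lambda^n$ (strong limit) be the asymptotic limit, and let $U$ be the isometric asymptote of $S_\lambda$: the unique isometry on $\overline{\operatorname{ran}A}=\mathcal H_0^\perp$ with $A^{1/2}S_\lambda=UA^{1/2}$. Put $$\alpha_u=\lim_{n\to\infty}\ \sum_{v\in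 \mathrm{Chi}^n(u)}\ \prod_{j=0}^{n-1}\lambda_{\mathrm{Par}^j(v)}^2 .$$ Then these limits exist, and there is a (unique) set $V'\subseteq V$ with $\mathcal H_0=\ell^2(V\setminus V')$ and $\mathcal H_0^\perp=\ell^2(V')$. The subgraph $\mathcal T'=(V',E\cap(V'\times V'))$ is a leafless directed tree, $\alpha_{v'}>0$ for $v'\in V'$, and $V'$ contains the parent of each of its vertices that has one. The isometric asymptote $U$ on $\mathcal H_0^\perp=\ell^2(V')$ is the weighted shift on $\mathcal T'$ with weights $$\beta_{v'}=\frac{\lambda_{v'}\sqrt{\alpha_{v'}}}{\sqrt{\alpha_{\mathrm{Par}(v')}}}\qquad (v'\in V' \text{ not the root of } \mathcal T').$$ Let $S^+$ and $S$ be the simple unilateral and bilateral shifts on $\ell^2(\mathbb Z_+)$ and $\ell^2(\mathbb Z)$, and let $\mathrm{Br}(\mathcal T')=\sum(|\mathrm{Chi}_{\mathcal T'}(u)|-1)\in\{0,1,\dots,\infty\}$, the sum being over the vertices $u$ of $\mathcal T'$ with more than one child in $\mathcal T'$ (multiplicity $\infty$ means countably infinitely many copies). Then: (i) if $\mathcal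 T$ has a root, $U$ is unitarily equivalent to the orthogonal sum of $\mathrm{Br}(\mathcal T')+1$ copies of $S^+$; (ii) if $\mathcal T$ has no root and $U$ is completely non-unitary (the only reducing subspace on which it is unitary is $\{0\}$), $U$ is unitarily equivalent to the orthogonal sum of $\mathrm{Br}(\mathcal T')$ copies of $S^+$; (iii) if $\mathcal T$ has no root and $U$ is not completely non-unitary, $U$ is unitarily equivalent to the orthogonal sum of $S$ and $\mathrm{Br}(\mathcal T')$ copies of $S^+$. Moreover, if $\mathcal T$ has no root, then $U$ is completely non-unitary if and only if $\sum_{v'\in\mathrm{Gen}_{\mathcal T'}(u')}\prod_{j=0}^\infty\beta_{\mathrm{Par}^j(v')}^2=0$ for some $u'\in V'$, and also if and only if this holds for every $u'\in V'$. -/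

import Mathlib

open Filter Topology
open scoped ENNReal

noncomputable section

namespace TreeShift

/-! ### Directed trees -/

section Graph

variable {V : Type*} (G : Digraph V)

/-- A directed tree: a connected directed graph in which every vertex has at most one parent and
which has no circuit. (No closed directed walk of positive length: no loops and no circuits.) -/
structure IsDirectedTree : Prop where
  connected : ∀ u v, Relation.ReflTransGen (fun a b => G.Adj a b ∨ G.Adj b a) u v
  parent_unique : ∀ u u' v, G.Adj u v → G.Adj u' v → u = u'
  acyclic : ∀ v, ¬ Relation.TransGen G.Adj v v

/-- The set of children of a vertex. -/
def chi (u : V) : Set V := {v | G.Adj u v}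

/-- The children of a set of vertices. -/
def chiSet (W : Set V) : Set V := ⋃ v ∈ W, chi G v

/-- The set of `n`-th generation descendants of `u`. -/
def chiPow (n : ℕ) (u : V) : Set V := (chiSet G)^[n] {u}

/-- `v` is a root if it is not a child of any vertex. -/
def IsRoot (v : V) : Prop := ∀ u, ¬ G.Adj u v

/-- The graph has a root. -/
def HasRoot : Prop := ∃ r, IsRoot G r

/-- Every vertex has a child. -/
def IsLeafless : Prop := ∀ u, (chi G u).Nonempty

open Classical in
/-- The parent of a vertex; for a root, which has no parent, the value is the root itself
and is irrelevant. -/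
def par (v : V) : V := if h : ∃ u, G.Adj u v then h.choose else v

/-- The whole generation (level) of `u`: those `v` that are reached from some `j`-th ancestor `w`
of `u` by going down `j` levels. -/
def gen (u : V) : Set V := {v | ∃ j w, u ∈ chiPow G j w ∧ v ∈ chiPow G j w}

/-- The branching index: the sum of `|chi u| - 1` over all branching vertices `u`, as an
extended natural number (the sum being the supremum of the finite partial sums). -/
def branchingIndex : ℕ∞ :=
  ⨆ s : Finset {u : V // 1 < (chi G u).encard}, ∑ u ∈ s, ((chi G u.1).encard - 1)

/-- The subgraph on the vertex set `W` with all edges between vertices of `W`. -/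
def inducedGraph (W : Set V) : Digraph W where
  Adj u v := G.Adj u.1 v.1

variable {G} in
lemma par_eq {u v : V} (hG : ∀ u u' v, G.Adj u v → G.Adj u' v → u = u') (h : G.Adj u v) :
    par G v = u := by
  have h' : ∃ u, G.Adj u v := ⟨u, h⟩
  rw [par, dif_pos h']
  exact hG _ _ _ h'.choose_spec h

lemma adj_par {v : V} (h : ∃ u, G.Adj u v) : G.Adj (par G v) v := by
  rw [par, dif_pos h]; exact h.choose_spec

end Graph

/-! ### The space of square summable functions -/

/-- The complex Hilbert space of square summable functions on `ι`. -/
abbrev Ell2 (ι : Type*) : Type _ := lp (fun _ : ι => ℂ) 2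

open Classical in
/-- The vectors of the standard orthonormal basis. -/
def basisVec {ι : Type*} (i : ι) : Ell2 ι := lp.single 2 i 1

/-- The closed subspace spanned by the `basisVec w` with `w ∈ W`. -/
def ell2Sub {ι : Type*} (W : Set ι) : Submodule ℂ (Ell2 ι) :=
  (Submodule.span ℂ (basisVec '' W)).topologicalClosure

lemma extend_norm_sq {ι κ : Type*} (φ : ι → κ) (hφ : Function.Injective φ) (f : ι → ℂ) :
    (fun k => ‖Function.extend φ f 0 k‖ ^ (2 : ℝ≥0∞).toReal) =
      Function.extend φ (fun i => ‖f i‖ ^ (2 : ℝ≥0∞).toReal) 0 := by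
  funext k
  by_cases h : ∃ i, φ i = k
  · obtain ⟨i, rfl⟩ := h
    simp [hφ.extend_apply]
  · simp [Function.extend_apply' _ _ _ h]

/-- The isometry `basisVec i ↦ basisVec (φ i)` induced by an injective map `φ`:
`f` is transported along `φ` and extended by zero. -/
def ell2Map {ι κ : Type*} (φ : ι → κ) (hφ : Function.Injective φ) : Ell2 ι →ₗᵢ[ℂ] Ell2 κ where
  toFun f := ⟨Function.extend φ f 0, by
    apply memℓp_gen
    rw [extend_norm_sq φ hφ]
    exact (summable_extend_zero hφ).2 ((lp.memℓp f).summable (by norm_num))⟩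
  map_add' f g := by
    ext k
    change Function.extend φ (⇑f + ⇑g) 0 k =
      Function.extend φ (⇑f) 0 k + Function.extend φ (⇑g) 0 k
    by_cases h : ∃ i, φ i = k
    · obtain ⟨i, rfl⟩ := h
      simp [hφ.extend_apply]
    · simp [Function.extend_apply' _ _ _ h]
  map_smul' c f := by
    ext k
    by_cases h : ∃ i, φ i = k
    · obtain ⟨i, rfl⟩ := h
      simp [hφ.extend_apply]
    · simp [Function.extend_apply' _ _ _ h]
  norm_map' f := by
    have h2 : 0 < (2 : ℝ≥0∞).toReal := by norm_num
    rw [lp.norm_eq_tsum_rpow h2, lp.norm_eq_tsum_rpow h2]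
    congr 1
    exact (congrArg tsum (extend_norm_sq φ hφ f)).trans (tsum_extend_zero hφ _)

lemma ell2Map_apply {ι κ : Type*} (φ : ι → κ) (hφ : Function.Injective φ) (f : Ell2 ι) (i : ι) :
    ell2Map φ hφ f (φ i) = f i := hφ.extend_apply _ _ _

lemma ell2Map_apply_of_notMem {ι κ : Type*} (φ : ι → κ) (hφ : Function.Injective φ) (f : Ell2 ι)
    (k : κ) (hk : ¬ ∃ i, φ i = k) : ell2Map φ hφ f k = 0 := Function.extend_apply' _ _ _ hk

/-- The inclusion of the square summable functions on a subset `W`: extension by zero. -/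
def ell2Incl {ι : Type*} (W : Set ι) : Ell2 W →ₗᵢ[ℂ] Ell2 ι :=
  ell2Map Subtype.val Subtype.val_injective

/-! ### Weighted shifts on directed trees -/

section Shift

variable {V : Type*} (G : Digraph V)

/-- The boundedness condition `sup_u √(∑_{v ∈ chi u} |lam v|²) < ∞` on the weights. Only the
weights of the vertices that are not roots enter. -/
def BoundedWeights (lam : V → ℝ) : Prop :=
  (∀ u, Summable fun v : chi G u => |lam v| ^ 2) ∧
    BddAbove (Set.range fun u => √(∑' v : chi G u, |lam v| ^ 2))

open Classical in
/-- Coordinates of the weighted shift: the value at `v` is `lam v * f (par v)` if `v` has a parent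
and `0` if `v` is a root. -/
def shiftFun (lam : V → ℝ) (f : V → ℂ) (v : V) : ℂ :=
  if ∃ u, G.Adj u v then (lam v : ℂ) * f (par G v) else 0

variable {G} in
open Classical in
lemma shiftFun_bound {lam : V → ℝ} (h : BoundedWeights G lam) :
    ∃ C : ℝ, 0 ≤ C ∧ ∀ (f : Ell2 V) (s : Finset V),
      ∑ v ∈ s, ‖shiftFun G lam f v‖ ^ (2 : ℝ≥0∞).toReal ≤
        (C * ‖f‖) ^ (2 : ℝ≥0∞).toReal := by
  obtain ⟨hs, C, hC⟩ := h
  have hC' : ∀ u, √(∑' v : chi G u, |lam v| ^ 2) ≤ C := fun u => hC ⟨u, rfl⟩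
  have h2 : (2 : ℝ≥0∞).toReal = (2 : ℕ) := by norm_num
  refine ⟨max C 0, le_max_right _ _, fun f s => ?_⟩
  have hnorm : ∀ t : Finset V, ∑ u ∈ t, ‖f u‖ ^ 2 ≤ ‖f‖ ^ 2 := fun t => by
    have := lp.sum_rpow_le_norm_rpow (p := 2) (by norm_num) f t
    simpa [h2, Real.rpow_natCast] using this
  simp only [h2, Real.rpow_natCast]
  have hfib : ∀ u, ∑ v ∈ s with par G v = u, ‖shiftFun G lam f v‖ ^ 2 ≤
      (max C 0) ^ 2 * ‖f u‖ ^ 2 := by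
    intro u
    have h1 : ∑ v ∈ s with par G v = u, ‖shiftFun G lam f v‖ ^ 2 ≤
        ∑ v ∈ s with v ∈ chi G u, |lam v| ^ 2 * ‖f u‖ ^ 2 := by
      have : ∀ v ∈ s.filter (fun v => par G v = u), v ∉ s.filter (fun v => v ∈ chi G u) →
          ‖shiftFun G lam f v‖ ^ 2 = 0 := by
        intro v hv hv'
        simp only [Finset.mem_filter, not_and] at hv hv'
        have : ¬ ∃ w, G.Adj w v := by
          intro hw
          apply hv' hv.1
          have := adj_par G hw
          rw [hv.2] at this
          exact this
        simp [shiftFun, this]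
      calc ∑ v ∈ s with par G v = u, ‖shiftFun G lam f v‖ ^ 2
          = ∑ v ∈ s.filter (fun v => par G v = u) with v ∈ chi G u,
              ‖shiftFun G lam f v‖ ^ 2 := by
            symm
            apply Finset.sum_subset (Finset.filter_subset _ _)
            intro v hv hv'
            apply this v hv
            intro hv''
            simp only [Finset.mem_filter] at hv hv' hv''
            exact hv' ⟨hv, hv''.2⟩
        _ ≤ ∑ v ∈ s.filter (fun v => par G v = u) with v ∈ chi G u, |lam v| ^ 2 * ‖f u‖ ^ 2 := by
            apply Finset.sum_le_sum
            intro v hv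
            simp only [Finset.mem_filter] at hv
            have hex : ∃ w, G.Adj w v := ⟨u, hv.2⟩
            rw [shiftFun, if_pos hex, hv.1.2, norm_mul, mul_pow, Complex.norm_real,
              Real.norm_eq_abs]
        _ ≤ _ := by
            apply Finset.sum_le_sum_of_subset_of_nonneg
            · intro v hv
              simp only [Finset.mem_filter] at hv ⊢
              exact ⟨hv.1.1, hv.2⟩
            · intros; positivity
    refine h1.trans ?_
    rw [← Finset.sum_mul]
    gcongr
    have h3 : ∑ v ∈ s with v ∈ chi G u, |lam v| ^ 2 ≤ ∑' v : chi G u, |lam v| ^ 2 := by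
      have := (hs u).sum_le_tsum (s.subtype (fun v => v ∈ chi G u)) (fun _ _ => by positivity)
      refine le_trans (le_of_eq ?_) this
      rw [Finset.sum_subtype_eq_sum_filter (f := fun v => |lam v| ^ 2)]
    refine h3.trans ?_
    have h4 : 0 ≤ ∑' v : chi G u, |lam v| ^ 2 := tsum_nonneg fun _ => by positivity
    calc _ = (√(∑' v : chi G u, |lam v| ^ 2)) ^ 2 := (Real.sq_sqrt h4).symm
      _ ≤ _ := by
        gcongr
        exact (hC' u).trans (le_max_left _ _)
  rw [← Finset.sum_fiberwise_of_maps_to (t := s.image (par G)) (g := par G)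
    (fun v hv => Finset.mem_image_of_mem _ hv)]
  calc _ ≤ ∑ u ∈ s.image (par G), (max C 0) ^ 2 * ‖f u‖ ^ 2 :=
        Finset.sum_le_sum fun u _ => hfib u
    _ = (max C 0) ^ 2 * ∑ u ∈ s.image (par G), ‖f u‖ ^ 2 := by rw [Finset.mul_sum]
    _ ≤ (max C 0) ^ 2 * ‖f‖ ^ 2 := by gcongr; exact hnorm _
    _ = _ := by ring

/-- The weighted shift as a linear map. -/
def shiftLin (lam : V → ℝ) (h : BoundedWeights G lam) : Ell2 V →ₗ[ℂ] Ell2 V where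
  toFun f := ⟨shiftFun G lam f, by
    obtain ⟨C, -, hC⟩ := shiftFun_bound h
    exact memℓp_gen' (hC f)⟩
  map_add' f g := by
    ext v
    change shiftFun G lam (⇑f + ⇑g) v = shiftFun G lam f v + shiftFun G lam g v
    by_cases hv : ∃ u, G.Adj u v
    · simp [shiftFun, hv, mul_add]
    · simp [shiftFun, hv]
  map_smul' c f := by
    ext v
    by_cases hv : ∃ u, G.Adj u v
    · simp [shiftFun, hv, mul_left_comm]
    · simp [shiftFun, hv]

/-- The weighted shift on `G` with weights `lam`: the bounded operator with
`basisVec u ↦ ∑_{v ∈ chi u} lam v • basisVec v` (see `hasSum_weightedShift_basisVec`). -/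
def weightedShift (lam : V → ℝ) (h : BoundedWeights G lam) : Ell2 V →L[ℂ] Ell2 V :=
  (shiftLin G lam h).mkContinuousOfExistsBound (by
    obtain ⟨C, hC0, hC⟩ := shiftFun_bound h
    exact ⟨C, fun f => lp.norm_le_of_forall_sum_le (by norm_num)
      (mul_nonneg hC0 (norm_nonneg f)) (hC f)⟩)

variable {G} in
lemma weightedShift_apply {lam : V → ℝ} (h : BoundedWeights G lam) (f : Ell2 V) :
    ⇑(weightedShift G lam h f) = shiftFun G lam f := rfl

variable {G} in
theorem hasSum_weightedShift_basisVec
    (hG : ∀ u u' v, G.Adj u v → G.Adj u' v → u = u')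
    {lam : V → ℝ} (h : BoundedWeights G lam) (u : V) :
    HasSum (fun v : chi G u => (lam v : ℂ) • basisVec v.1)
      (weightedShift G lam h (basisVec u)) := by
  classical
  have h1 := lp.hasSum_single (E := fun _ : V => ℂ) (p := 2) (by norm_num)
    (weightedShift G lam h (basisVec u))
  have h2 : ∀ v, weightedShift G lam h (basisVec u) v = if G.Adj u v then (lam v : ℂ) else 0 := by
    intro v
    rw [weightedShift_apply, shiftFun]
    by_cases huv : G.Adj u v
    · rw [if_pos ⟨u, huv⟩, if_pos huv, par_eq hG huv]
      simp [basisVec]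
    · rw [if_neg huv]
      split_ifs with hex
      · have : par G v ≠ u := by
          rintro rfl
          exact huv (adj_par G hex)
        simp [basisVec, this]
      · rfl
  have h3 := (hasSum_subtype_iff_of_support_subset (s := chi G u) (by
    intro v hv
    by_contra hv'
    apply hv
    change ¬ G.Adj u v at hv'
    simp only [h2, if_neg hv']
    exact map_zero (lp.singleAddMonoidHom (E := fun _ : V => ℂ) 2 v))).2 h1
  convert h3 using 1
  funext v
  have hv : G.Adj u v.1 := v.2
  rw [Function.comp_apply, h2, if_pos hv, basisVec, ← lp.single_smul]
  simp

/-- `alpha u = lim_n ∑_{v ∈ chiⁿ(u)} ∏_{j < n} lam (parʲ v)²`. -/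
def alphaSum (lam : V → ℝ) (n : ℕ) (u : V) : ℝ :=
  ∑' v : chiPow G n u, ∏ j ∈ Finset.range n, lam ((par G)^[j] v) ^ 2

/-- The limit `lim_n ∑_{v ∈ chiⁿ(u)} ∏_{j < n} lam (parʲ v)²`. -/
def alpha (lam : V → ℝ) (u : V) : ℝ := limUnder atTop fun n => alphaSum G lam n u

end Shift

/-! ### Asymptotic limit and isometric asymptote of a contraction -/

section Operator

variable {H : Type*} [NormedAddCommGroup H] [InnerProductSpace ℂ H]

/-- The stable subspace: all vectors whose orbit converges to `0`. -/
def stableSubspace (T : H →L[ℂ] H) : Submodule ℂ H where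
  carrier := {h | Tendsto (fun n : ℕ => (T ^ n) h) atTop (𝓝 0)}
  zero_mem' := by
    change Tendsto (fun n : ℕ => (T ^ n) (0 : H)) atTop (𝓝 0)
    simp only [map_zero]
    exact tendsto_const_nhds
  add_mem' {a b} ha hb := by
    change Tendsto (fun n : ℕ => (T ^ n) (a + b)) atTop (𝓝 0)
    have h := Tendsto.add (f := fun n : ℕ => (T ^ n) a) (g := fun n : ℕ => (T ^ n) b) ha hb
    rw [add_zero] at h
    exact h.congr fun n => ((T ^ n).map_add a b).symm
  smul_mem' c x hx := by
    change Tendsto (fun n : ℕ => (T ^ n) (c • x)) atTop (𝓝 0)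
    have h := Tendsto.const_smul (f := fun n : ℕ => (T ^ n) x) hx c
    rw [smul_zero] at h
    exact h.congr fun n => ((T ^ n).map_smul c x).symm

/-- `T` is stable (of class `C_{0·}`). -/
def IsStable (T : H →L[ℂ] H) : Prop := stableSubspace T = ⊤

lemma antitone_orbit {T : H →L[ℂ] H} (hT : ‖T‖ ≤ 1) (h : H) :
    Antitone fun n : ℕ => ‖(T ^ n) h‖ := by
  refine antitone_nat_of_succ_le fun n => ?_
  rw [pow_succ', mul_apply_eq_comp]
  exact (T.le_of_opNorm_le hT _).trans (by rw [one_mul])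

variable [CompleteSpace H]

/-- `A` is the limit of `T*ⁿ Tⁿ` in the strong operator topology. -/
def IsAsymptoticLimit (T A : H →L[ℂ] H) : Prop :=
  ∀ h, Tendsto (fun n : ℕ => ((ContinuousLinearMap.adjoint T) ^ n) ((T ^ n) h)) atTop (𝓝 (A h))

lemma norm_pow_le_one {T : H →L[ℂ] H} (hT : ‖T‖ ≤ 1) (n : ℕ) : ‖T ^ n‖ ≤ 1 := by
  induction n with
  | zero => rw [pow_zero]; exact ContinuousLinearMap.norm_id_le
  | succ k ih =>
    rw [pow_succ]
    exact (norm_mul_le _ _).trans (mul_le_one₀ ih (norm_nonneg _) hT)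

lemma adjoint_pow' (T : H →L[ℂ] H) (n : ℕ) :
    (ContinuousLinearMap.adjoint T) ^ n = ContinuousLinearMap.adjoint (T ^ n) := by
  rw [← ContinuousLinearMap.star_eq_adjoint, ← ContinuousLinearMap.star_eq_adjoint, star_pow]

lemma inner_gram (T : H →L[ℂ] H) (n : ℕ) (x y : H) :
    inner ℂ (((ContinuousLinearMap.adjoint T) ^ n) ((T ^ n) x)) y
      = inner ℂ ((T ^ n) x) ((T ^ n) y) := by
  rw [adjoint_pow', ContinuousLinearMap.adjoint_inner_left]

lemma norm_gram_sub_sq_le {T : H →L[ℂ] H} (hT : ‖T‖ ≤ 1) (n k : ℕ) (h : H) :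
    ‖((ContinuousLinearMap.adjoint T) ^ n) ((T ^ n) h)
        - ((ContinuousLinearMap.adjoint T) ^ (n + k)) ((T ^ (n + k)) h)‖ ^ 2
      ≤ ‖(T ^ n) h‖ ^ 2 - ‖(T ^ (n + k)) h‖ ^ 2 := by
  have hTs : ‖ContinuousLinearMap.adjoint T‖ ≤ 1 := by simpa using hT
  set x := (T ^ n) h with hx
  have e1 : (T ^ (n + k)) h = (T ^ k) x := by rw [add_comm, pow_add]; rfl
  set y := ((ContinuousLinearMap.adjoint T) ^ k) ((T ^ k) x) with hy
  have e2 : ((ContinuousLinearMap.adjoint T) ^ n) x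
        - ((ContinuousLinearMap.adjoint T) ^ (n + k)) ((T ^ (n + k)) h)
      = ((ContinuousLinearMap.adjoint T) ^ n) (x - y) := by
    rw [e1, pow_add, map_sub]; rfl
  rw [e2, e1]
  have h1 : ‖((ContinuousLinearMap.adjoint T) ^ n) (x - y)‖ ≤ ‖x - y‖ := by
    simpa using (((ContinuousLinearMap.adjoint T) ^ n).le_of_opNorm_le
      (norm_pow_le_one hTs n) (x - y))
  have h2 : ‖y‖ ≤ ‖(T ^ k) x‖ := by
    simpa only [one_mul] using (((ContinuousLinearMap.adjoint T) ^ k).le_of_opNorm_le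
      (norm_pow_le_one hTs k) ((T ^ k) x))
  have h3 : RCLike.re (inner ℂ x y) = ‖(T ^ k) x‖ ^ 2 := by
    rw [inner_re_symm, hy, inner_gram, inner_self_eq_norm_sq]
  have h4 := norm_sub_sq (𝕜 := ℂ) x y
  rw [h3] at h4
  have h5 : ‖y‖ ^ 2 ≤ ‖(T ^ k) x‖ ^ 2 := by gcongr
  have h6 : ‖((ContinuousLinearMap.adjoint T) ^ n) (x - y)‖ ^ 2 ≤ ‖x - y‖ ^ 2 := by gcongr
  linarith

theorem exists_asymptoticLimit (T : H →L[ℂ] H) (hT : ‖T‖ ≤ 1) :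
    ∃ A, IsAsymptoticLimit T A := by
  have hlim : ∀ h, ∃ y, Tendsto
      (fun n : ℕ => ((ContinuousLinearMap.adjoint T) ^ n) ((T ^ n) h)) atTop (𝓝 y) := by
    intro h
    apply cauchySeq_tendsto_of_complete
    have hanti : Antitone fun n : ℕ => ‖(T ^ n) h‖ ^ 2 := fun n m hnm => by
      have := antitone_orbit hT h hnm
      simp only at this ⊢
      gcongr
    have hc : Tendsto (fun n : ℕ => ‖(T ^ n) h‖ ^ 2) atTop (𝓝 (⨅ n : ℕ, ‖(T ^ n) h‖ ^ 2)) :=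
      tendsto_atTop_ciInf hanti ⟨0, by rintro _ ⟨n, rfl⟩; positivity⟩
    have hcau := hc.cauchySeq
    rw [Metric.cauchySeq_iff'] at hcau ⊢
    intro ε hε
    obtain ⟨N, hN⟩ := hcau (ε ^ 2) (by positivity)
    refine ⟨N, fun n hn => ?_⟩
    obtain ⟨k, rfl⟩ := Nat.exists_eq_add_of_le hn
    have h1 := hN (N + k) hn
    rw [dist_comm, Real.dist_eq] at h1
    have h2 := norm_gram_sub_sq_le hT N k h
    rw [dist_comm, dist_eq_norm]
    exact lt_of_pow_lt_pow_left₀ 2 hε.le (h2.trans_lt ((le_abs_self _).trans_lt h1))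
  choose A hA using hlim
  exact ⟨continuousLinearMapOfTendsto
    (fun n : ℕ => (ContinuousLinearMap.adjoint T) ^ n * T ^ n) (tendsto_pi_nhds.2 hA), hA⟩

/-- The asymptotic limit `lim T*ⁿ Tⁿ` (in the strong operator topology) of a contraction. -/
def asymptoticLimit (T : H →L[ℂ] H) (hT : ‖T‖ ≤ 1) : H →L[ℂ] H :=
  (exists_asymptoticLimit T hT).choose

lemma asymptoticLimit_spec (T : H →L[ℂ] H) (hT : ‖T‖ ≤ 1) :
    IsAsymptoticLimit T (asymptoticLimit T hT) := (exists_asymptoticLimit T hT).choose_spec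

lemma tendsto_norm_sq_orbit (T : H →L[ℂ] H) (hT : ‖T‖ ≤ 1) (h : H) :
    Tendsto (fun n : ℕ => (((‖(T ^ n) h‖ ^ 2 : ℝ)) : ℂ)) atTop
      (𝓝 (inner ℂ (asymptoticLimit T hT h) h)) := by
  refine ((asymptoticLimit_spec T hT h).inner tendsto_const_nhds).congr fun n => ?_
  rw [inner_gram, inner_self_eq_norm_sq_to_K]
  norm_cast

lemma tendsto_norm_sq_orbit_re (T : H →L[ℂ] H) (hT : ‖T‖ ≤ 1) (h : H) :
    Tendsto (fun n : ℕ => ‖(T ^ n) h‖ ^ 2) atTop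
      (𝓝 (inner ℂ (asymptoticLimit T hT h) h).re) :=
  (Complex.continuous_re.tendsto _).comp (tendsto_norm_sq_orbit T hT h)

lemma asymptoticLimit_nonneg (T : H →L[ℂ] H) (hT : ‖T‖ ≤ 1) : 0 ≤ asymptoticLimit T hT := by
  rw [ContinuousLinearMap.nonneg_iff_isPositive, ContinuousLinearMap.isPositive_iff_complex]
  intro x
  have h1 := tendsto_norm_sq_orbit_re T hT x
  have h2 := (Complex.continuous_ofReal.tendsto _).comp h1
  exact ⟨tendsto_nhds_unique h2 (tendsto_norm_sq_orbit T hT x),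
    ge_of_tendsto' h1 fun n => by positivity⟩

lemma sqrt_selfAdjoint (A : H →L[ℂ] H) (x y : H) :
    inner ℂ (CFC.sqrt A x) y = inner ℂ x (CFC.sqrt A y) := by
  have h := (ContinuousLinearMap.nonneg_iff_isPositive _).1 (CFC.sqrt_nonneg A)
  exact h.inner_left_eq_inner_right x y

lemma tendsto_sqrt (T : H →L[ℂ] H) (hT : ‖T‖ ≤ 1) (h : H) :
    Tendsto (fun n : ℕ => ‖(T ^ n) h‖ ^ 2) atTop
      (𝓝 (‖CFC.sqrt (asymptoticLimit T hT) h‖ ^ 2)) := by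
  convert tendsto_norm_sq_orbit_re T hT h using 2
  set B := CFC.sqrt (asymptoticLimit T hT) with hB
  have h1 : asymptoticLimit T hT h = B (B h) := by
    have := CFC.sqrt_mul_sqrt_self (asymptoticLimit T hT) (asymptoticLimit_nonneg T hT)
    conv_lhs => rw [← this]
    rfl
  rw [h1, hB, sqrt_selfAdjoint]
  exact (inner_self_eq_norm_sq (𝕜 := ℂ) _).symm

lemma mem_stableSubspace_iff (T : H →L[ℂ] H) (hT : ‖T‖ ≤ 1) (h : H) :
    h ∈ stableSubspace T ↔ CFC.sqrt (asymptoticLimit T hT) h = 0 := by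
  have key : h ∈ stableSubspace T ↔ Tendsto (fun n : ℕ => ‖(T ^ n) h‖ ^ 2) atTop (𝓝 0) := by
    change Tendsto (fun n : ℕ => (T ^ n) h) atTop (𝓝 0) ↔ _
    rw [tendsto_zero_iff_norm_tendsto_zero]
    constructor
    · intro h1
      simpa only [ne_eq, OfNat.ofNat_ne_zero, not_false_eq_true, zero_pow] using h1.pow 2
    · intro h1
      have h2 := h1.sqrt
      simpa only [Real.sqrt_zero, Real.sqrt_sq (norm_nonneg _)] using h2
  rw [key]
  constructor
  · intro h1
    have := tendsto_nhds_unique h1 (tendsto_sqrt T hT h)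
    simpa using this.symm
  · intro h1
    have := tendsto_sqrt T hT h
    rw [h1] at this
    simpa only [norm_zero, ne_eq, OfNat.ofNat_ne_zero, not_false_eq_true, zero_pow] using this

/-- The intertwining map `X h = A^{1/2} h` with values in the orthocomplement of the stable
subspace, where `A` is the asymptotic limit of the contraction `T`. -/
def asymptoteMap (T : H →L[ℂ] H) (hT : ‖T‖ ≤ 1) : H →L[ℂ] (stableSubspace T)ᗮ :=
  (CFC.sqrt (asymptoticLimit T hT)).codRestrict _ fun h => by
    rw [Submodule.mem_orthogonal]
    intro u hu
    rw [← sqrt_selfAdjoint, (mem_stableSubspace_iff T hT u).1 hu, inner_zero_left]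

lemma asymptoteMap_norm_comp (T : H →L[ℂ] H) (hT : ‖T‖ ≤ 1) (h : H) :
    ‖asymptoteMap T hT (T h)‖ = ‖asymptoteMap T hT h‖ := by
  have h1 := tendsto_sqrt T hT (T h)
  have h2 := (tendsto_add_atTop_iff_nat 1).2 (tendsto_sqrt T hT h)
  have h3 := tendsto_nhds_unique (h1.congr fun n => by rw [pow_succ]; rfl) h2
  exact (sq_eq_sq₀ (norm_nonneg _) (norm_nonneg _)).1 h3

lemma asymptoteMap_denseRange (T : H →L[ℂ] H) (hT : ‖T‖ ≤ 1) :
    DenseRange (asymptoteMap T hT) := by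
  have h1 : (LinearMap.range (asymptoteMap T hT).toLinearMap)ᗮ = ⊥ := by
    rw [Submodule.eq_bot_iff]
    intro x hx
    rw [Submodule.mem_orthogonal] at hx
    have h2 : CFC.sqrt (asymptoticLimit T hT) (x : H) = 0 := by
      have h3 := hx (asymptoteMap T hT (CFC.sqrt (asymptoticLimit T hT) (x : H))) ⟨_, rfl⟩
      rw [Submodule.coe_inner] at h3
      change inner ℂ (CFC.sqrt (asymptoticLimit T hT)
        (CFC.sqrt (asymptoticLimit T hT) (x : H))) (x : H) = 0 at h3
      rw [sqrt_selfAdjoint] at h3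
      exact inner_self_eq_zero.1 h3
    have h4 := (mem_stableSubspace_iff T hT _).2 h2
    have h5 := (Submodule.mem_orthogonal _ _).1 x.2 _ h4
    exact Subtype.ext (inner_self_eq_zero.1 h5)
  have h6 := (Submodule.topologicalClosure_eq_top_iff
    (K := LinearMap.range (asymptoteMap T hT).toLinearMap)).2 h1
  exact Submodule.dense_iff_topologicalClosure_eq_top.2 h6

/-- There is a unique isometry `U` with `X T = U X`. -/
theorem existsUnique_isometricAsymptote (T : H →L[ℂ] H) (hT : ‖T‖ ≤ 1) :
    ∃! U : (stableSubspace T)ᗮ →ₗᵢ[ℂ] (stableSubspace T)ᗮ,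
      ∀ h, asymptoteMap T hT (T h) = U (asymptoteMap T hT h) := by
  set X := asymptoteMap T hT with hX
  have hd : DenseRange X.toLinearMap := asymptoteMap_denseRange T hT
  have hn : ∃ C : ℝ, ∀ x, ‖(X.toLinearMap ∘ₗ T.toLinearMap) x‖ ≤ C * ‖X.toLinearMap x‖ :=
    ⟨1, fun x => by rw [one_mul]; exact (asymptoteMap_norm_comp T hT x).le⟩
  set U₀ := (X.toLinearMap ∘ₗ T.toLinearMap).extendOfNorm X.toLinearMap with hU₀
  have hU : ∀ h, U₀ (X h) = X (T h) := fun h => LinearMap.extendOfNorm_eq hd hn h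
  refine ⟨⟨U₀.toLinearMap, fun y => ?_⟩, fun h => (hU h).symm, fun W hW => ?_⟩
  · refine hd.induction_on (p := fun y => ‖U₀ y‖ = ‖y‖) y
      (isClosed_eq (by fun_prop) (by fun_prop)) fun h => ?_
    exact (congrArg norm (hU h)).trans (asymptoteMap_norm_comp T hT h)
  · ext1 y
    refine hd.induction_on (p := fun y => W y = U₀ y) y
      (isClosed_eq W.continuous U₀.continuous) fun h => ?_
    exact (hW h).symm.trans (hU h).symm

/-- The isometric asymptote of a contraction `T`: the unique isometry `U` on the orthocomplement
of the stable subspace (the closure of the range of `A`) with `X T = U X`. -/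
def isometricAsymptote (T : H →L[ℂ] H) (hT : ‖T‖ ≤ 1) :
    (stableSubspace T)ᗮ →ₗᵢ[ℂ] (stableSubspace T)ᗮ :=
  (existsUnique_isometricAsymptote T hT).choose

lemma isometricAsymptote_spec (T : H →L[ℂ] H) (hT : ‖T‖ ≤ 1) (h : H) :
    asymptoteMap T hT (T h) = isometricAsymptote T hT (asymptoteMap T hT h) :=
  (existsUnique_isometricAsymptote T hT).choose_spec.1 h

/-- A completely non-unitary operator: the only reducing (closed, invariant under `T` and `T*`)
subspace on which `T` acts as a unitary operator is `{0}`. -/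
def IsCNU (T : H →L[ℂ] H) : Prop :=
  ∀ M : Submodule ℂ H, IsClosed (M : Set H) → (∀ x ∈ M, T x ∈ M) →
    (∀ x ∈ M, ContinuousLinearMap.adjoint T x ∈ M) →
    (∀ x ∈ M, ‖T x‖ = ‖x‖) → (∀ y ∈ M, ∃ x ∈ M, T x = y) → M = ⊥

end Operator

/-! ### Unitary equivalence, direct sums and the simple shifts -/

/-- Unitary equivalence of operators. -/
def UnitarilyEquivalent {H K : Type*} [NormedAddCommGroup H] [InnerProductSpace ℂ H]
    [NormedAddCommGroup K] [InnerProductSpace ℂ K] (T : H →L[ℂ] H) (T' : K →L[ℂ] K) : Prop :=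
  ∃ W : H ≃ₗᵢ[ℂ] K, ∀ x, W (T x) = T' (W x)

/-- The simple bilateral shift `e n ↦ e (n + 1)` on the square summable functions on `ℤ`. -/
def bilateralShift : Ell2 ℤ →ₗᵢ[ℂ] Ell2 ℤ := ell2Map (fun n : ℤ => n + 1) (add_left_injective 1)

/-- The simple unilateral shift `e k ↦ e (k + 1)` on the square summable functions on `ℕ`. -/
def unilateralShift : Ell2 ℕ →ₗᵢ[ℂ] Ell2 ℕ := ell2Map (fun n : ℕ => n + 1) (add_left_injective 1)

/-- An index set with `n` elements (countably infinite if `n = ∞`). -/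
abbrev IndexSet (n : ℕ∞) : Type := {i : ℕ // (i : ℕ∞) < n}

/-- The Hilbert space direct sum of `n` copies of the square summable functions on `ℕ`. -/
abbrev Ell2Copies (n : ℕ∞) : Type := lp (fun _ : IndexSet n => Ell2 ℕ) 2

/-- The unilateral shift of multiplicity `n`: the orthogonal sum of `n` copies of the simple
unilateral shift (countably infinitely many if `n = ∞`). -/
def unilateralShiftMult (n : ℕ∞) : Ell2Copies n →L[ℂ] Ell2Copies n :=
  lp.mapCLM 2 (fun _ : IndexSet n => unilateralShift.toContinuousLinearMap) zero_le_one
    (fun _ => LinearIsometry.norm_toContinuousLinearMap_le _)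

/-- The orthogonal sum of two operators on the Hilbert space direct sum. -/
def orthSum {H K : Type*} [NormedAddCommGroup H] [InnerProductSpace ℂ H]
    [NormedAddCommGroup K] [InnerProductSpace ℂ K] (T : H →L[ℂ] H) (T' : K →L[ℂ] K) :
    WithLp 2 (H × K) →L[ℂ] WithLp 2 (H × K) :=
  (WithLp.prodContinuousLinearEquiv 2 ℂ H K).symm.toContinuousLinearMap ∘L
    (T.prodMap T') ∘L (WithLp.prodContinuousLinearEquiv 2 ℂ H K).toContinuousLinearMap

/-! ### The subtree carrying the orthocomplement of the stable subspace -/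

section Subtree

variable {V : Type*} (G : Digraph V) (lam : V → ℝ) (h : BoundedWeights G lam)

/-- The set `V'` of vertices whose basis vectors lie in the orthocomplement of the stable
subspace of the weighted shift. -/
def coreSet : Set V := {v | basisVec v ∈ (stableSubspace (weightedShift G lam h))ᗮ}

/-- The weights `lam v * √(alpha v) / √(alpha (par v))` on `V'`. -/
def coreWeight (v : coreSet G lam h) : ℝ :=
  lam v * √(alpha G lam v) / √(alpha G lam (par G v))

/-- The subgraph `T'` on `V'`. -/
def coreTree : Digraph (coreSet G lam h) := inducedGraph G (coreSet G lam h)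

end Subtree

end TreeShift

end

open TreeShift

/-
The operators `S*ⁿ Sⁿ` are diagonal in the basis of the vertices, because distinct vertices have
disjoint sets of `n`-th descendants; hence `A` is the diagonal operator with entries `α u`, the
stable subspace is spanned by the vertices with `α u = 0`, and comparing coordinates in
`A^{1/2} S = U A^{1/2}` identifies `U` with the weighted shift on the remaining vertices with the
weights `β`. Since `U` is isometric, it is determined up to unitary equivalence by its Wold
decomposition, that is, by the dimension of `(ran U)ᗮ` and by its unitary part.

For the dimension, choose a child `s u` of each vertex `u`. The families `U e_u` and `e_{s u}` are
orthonormal and have a real symmetric Gram matrix between them, so a unitary reflection exchanges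
them, and `(ran U)ᗮ` is carried to the space of the vertices outside the range of `s`; their number
is `Br`, plus one for the root.

The unitary part is `0` if there is a root. Otherwise a vector in the range of every power of `U`
is on each level a multiple of the vector with coordinates `√(∏ j, β (parʲ v) ^ 2)`, and `U` maps
these vectors to each other from level to level: the unitary part is either `0`, when all the
products vanish, or a bilateral shift.
-/

namespace TreeShift

section Tree

variable {V : Type*} {G : Digraph V}

lemma par_eq_self_of_isRoot {v : V} (h : IsRoot G v) : par G v = v :=
  dif_neg fun ⟨u, hu⟩ => h u hu

lemma not_isRoot_iff {v : V} : ¬ IsRoot G v ↔ ∃ u, G.Adj u v := by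
  simp [IsRoot]

lemma adj_par_of_not_isRoot {v : V} (h : ¬ IsRoot G v) : G.Adj (par G v) v :=
  adj_par G (not_isRoot_iff.1 h)

lemma not_isRoot_of_not_hasRoot (hr : ¬ HasRoot G) (v : V) : ¬ IsRoot G v := fun h => hr ⟨v, h⟩

lemma iterate_par_of_isRoot {v : V} (h : IsRoot G v) (n : ℕ) : (par G)^[n] v = v :=
  Function.iterate_fixed (par_eq_self_of_isRoot h) n

lemma transGen_iterate_par (hr : ¬ HasRoot G) (n : ℕ) (v : V) :
    Relation.TransGen G.Adj ((par G)^[n + 1] v) v := by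
  induction n with
  | zero => exact .single (adj_par_of_not_isRoot (not_isRoot_of_not_hasRoot hr v))
  | succ n ih =>
    rw [Function.iterate_succ_apply']
    exact .head (adj_par_of_not_isRoot (not_isRoot_of_not_hasRoot hr _)) ih

lemma countable_iterate_preimage_singleton {α : Type*} {f : α → α}
    (hf : ∀ a, (f ⁻¹' {a}).Countable) (n : ℕ) (a : α) : (f^[n] ⁻¹' {a}).Countable := by
  induction n generalizing a with
  | zero => exact Set.countable_singleton a
  | succ n ih =>
    rw [Function.iterate_succ', Set.preimage_comp, ← Set.biUnion_preimage_singleton]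
    exact (hf a).biUnion fun b _ => ih b

lemma countable_par_preimage_singleton {u : V} (h : (chi G u).Countable) :
    (par G ⁻¹' {u}).Countable := by
  refine (h.insert u).mono fun v (hv : par G v = u) => ?_
  by_cases hr : IsRoot G v
  · exact Or.inl ((par_eq_self_of_isRoot hr).symm.trans hv)
  · exact Or.inr (hv ▸ adj_par_of_not_isRoot hr)

namespace IsDirectedTree

variable (hG : IsDirectedTree G)
include hG

lemma par_eq {u v : V} (h : G.Adj u v) : par G v = u := TreeShift.par_eq hG.parent_unique h

lemma exists_iterate_par_eq (u v : V) : ∃ m n : ℕ, (par G)^[m] u = (par G)^[n] v := by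
  induction hG.connected u v with
  | refl => exact ⟨0, 0, rfl⟩
  | @tail b c _ h ih =>
    obtain ⟨m, n, hmn⟩ := ih
    rcases h with h | h
    · exact ⟨m, n + 1, by rw [hmn, Function.iterate_succ_apply, hG.par_eq h]⟩
    · refine ⟨m + 1, n, ?_⟩
      rw [Function.iterate_succ_apply', hmn, ← Function.iterate_succ_apply' (par G),
        Function.iterate_succ_apply, hG.par_eq h]

lemma isRoot_unique {r r' : V} (h : IsRoot G r) (h' : IsRoot G r') : r = r' := by
  obtain ⟨m, n, hmn⟩ := hG.exists_iterate_par_eq r r'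
  rwa [iterate_par_of_isRoot h, iterate_par_of_isRoot h'] at hmn

lemma exists_iterate_par_eq_root {r : V} (h : IsRoot G r) (v : V) :
    ∃ n : ℕ, (par G)^[n] v = r := by
  obtain ⟨n, m, hnm⟩ := hG.exists_iterate_par_eq v r
  exact ⟨n, hnm.trans (iterate_par_of_isRoot h m)⟩

lemma forall_of_iff_par {p : V → Prop} (h : ∀ v, p v ↔ p (par G v)) {u : V} (hu : p u) (v : V) :
    p v := by
  have iff_iterate (n : ℕ) (w : V) : p w ↔ p ((par G)^[n] w) := by
    induction n generalizing w with
    | zero => rfl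
    | succ n ih => rw [Function.iterate_succ_apply, ← ih, ← h]
  obtain ⟨m, n, hmn⟩ := hG.exists_iterate_par_eq u v
  rw [iff_iterate n v, ← hmn, ← iff_iterate m u]
  exact hu

lemma countable (hchi : ∀ u, (chi G u).Countable) : Countable V := by
  rcases isEmpty_or_nonempty V with _ | ⟨⟨o⟩⟩
  · infer_instance
  rw [← Set.countable_univ_iff]
  refine (Set.countable_iUnion fun m : ℕ => Set.countable_iUnion fun n : ℕ =>
    countable_iterate_preimage_singleton (fun u => countable_par_preimage_singleton (hchi u)) n
      ((par G)^[m] o)).mono fun v _ => ?_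
  obtain ⟨m, n, h⟩ := hG.exists_iterate_par_eq o v
  exact Set.mem_iUnion₂.2 ⟨m, n, h.symm⟩

lemma iterate_par_injective (hr : ¬ HasRoot G) (v : V) :
    Function.Injective fun n : ℕ => (par G)^[n] v := by
  refine .of_lt_imp_ne fun a b hab h => ?_
  obtain ⟨k, rfl⟩ := Nat.exists_eq_add_of_lt hab
  have hcycle := transGen_iterate_par hr k ((par G)^[a] v)
  rw [← Function.iterate_add_apply, add_comm, ← add_assoc, ← h] at hcycle
  exact hG.acyclic _ hcycle

lemma exists_height (hr : ¬ HasRoot G) : ∃ ht : V → ℤ, ∀ v, ht v = ht (par G v) + 1 := by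
  rcases isEmpty_or_nonempty V with hV | ⟨⟨o⟩⟩
  · exact ⟨fun _ => 0, fun v => (hV.false v).elim⟩
  choose m n hmn using fun v => hG.exists_iterate_par_eq v o
  have sub_eq (v : V) (a b : ℕ) (h : (par G)^[a] v = (par G)^[b] o) :
      (m v : ℤ) - n v = a - b := by
    have h' : (par G)^[a + n v] o = (par G)^[m v + b] o := by
      rw [Function.iterate_add_apply, ← hmn, ← Function.iterate_add_apply, add_comm,
        Function.iterate_add_apply, h, ← Function.iterate_add_apply]
    have := hG.iterate_par_injective hr o h'
    omega
  refine ⟨fun v => (m v : ℤ) - n v, fun v => ?_⟩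
  have := sub_eq v (m (par G v) + 1) (n (par G v)) (by rw [Function.iterate_succ_apply, hmn])
  push_cast at this
  linarith

lemma mem_chiPow {n : ℕ} {u v : V} :
    v ∈ chiPow G n u ↔ (par G)^[n] v = u ∧ ∀ j < n, ¬ IsRoot G ((par G)^[j] v) := by
  induction n generalizing v with
  | zero => simp [chiPow]
  | succ n ih =>
    have mem_succ : v ∈ chiPow G (n + 1) u ↔ ∃ w ∈ chiPow G n u, G.Adj w v := by
      rw [chiPow, Function.iterate_succ_apply']
      exact Set.mem_iUnion₂.trans (by simp only [exists_prop]; rfl)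
    rw [mem_succ]
    constructor
    · rintro ⟨w, hw, hwv⟩
      obtain rfl := hG.par_eq hwv
      obtain ⟨h1, h2⟩ := ih.1 hw
      refine ⟨h1, fun j hj => ?_⟩
      cases j with
      | zero => exact not_isRoot_iff.2 ⟨_, hwv⟩
      | succ j => exact h2 j (by omega)
    · rintro ⟨h1, h2⟩
      exact ⟨par G v, ih.2 ⟨h1, fun j hj => h2 (j + 1) (by omega)⟩,
        adj_par_of_not_isRoot (h2 0 (by omega))⟩

end IsDirectedTree

section Height

variable {ht : V → ℤ} (hht : ∀ v, ht v = ht (par G v) + 1)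
include hht

lemma height_iterate_par (n : ℕ) (v : V) : ht ((par G)^[n] v) = ht v - n := by
  induction n with
  | zero => simp
  | succ n ih =>
    have := hht ((par G)^[n] v)
    rw [Function.iterate_succ_apply']
    push_cast
    linarith

lemma not_hasRoot_of_height : ¬ HasRoot G := by
  rintro ⟨r, h⟩
  have := hht r
  rw [par_eq_self_of_isRoot h] at this
  omega

lemma IsDirectedTree.exists_iterate_par_eq_of_height_eq (hG : IsDirectedTree G) {v w : V}
    (h : ht v = ht w) : ∃ n : ℕ, (par G)^[n] v = (par G)^[n] w := by
  obtain ⟨m, n, hmn⟩ := hG.exists_iterate_par_eq v w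
  have hht_eq := congrArg ht hmn
  rw [height_iterate_par hht, height_iterate_par hht, h] at hht_eq
  obtain rfl : m = n := by omega
  exact ⟨m, hmn⟩

end Height

section InducedGraph

variable {W : Set V} (hW : Set.MapsTo (par G) W W)
include hW

lemma isRoot_inducedGraph_iff {v : W} : IsRoot (inducedGraph G W) v ↔ IsRoot G v := by
  refine ⟨fun h => ?_, fun h u => h u⟩
  by_contra hr
  exact h ⟨par G v, hW v.2⟩ (adj_par_of_not_isRoot hr)

lemma reflTransGen_inducedGraph_iterate_par (n : ℕ) (v : W) :
    Relation.ReflTransGen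
      (fun a b => (inducedGraph G W).Adj a b ∨ (inducedGraph G W).Adj b a)
      v ⟨(par G)^[n] v, hW.iterate n v.2⟩ := by
  induction n with
  | zero => exact .refl
  | succ n ih =>
    simp only [Function.iterate_succ_apply']
    by_cases hr : IsRoot G ((par G)^[n] v)
    · simpa only [par_eq_self_of_isRoot hr] using ih
    · exact ih.tail (Or.inr (adj_par_of_not_isRoot hr))

namespace IsDirectedTree

variable (hG : IsDirectedTree G)
include hG

lemma inducedGraph : IsDirectedTree (inducedGraph G W) where
  connected u v := by
    obtain ⟨m, n, h⟩ := hG.exists_iterate_par_eq u.1 v.1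
    have : Std.Symm (fun a b => (TreeShift.inducedGraph G W).Adj a b ∨
      (TreeShift.inducedGraph G W).Adj b a) := ⟨fun _ _ => Or.symm⟩
    have hu := reflTransGen_inducedGraph_iterate_par hW m u
    simp only [h] at hu
    exact hu.trans (Relation.ReflTransGen.stdSymm.symm _ _
      (reflTransGen_inducedGraph_iterate_par hW n v))
  parent_unique u u' v h h' := Subtype.ext (hG.parent_unique _ _ _ h h')
  acyclic v h := hG.acyclic v.1 (h.lift Subtype.val fun _ _ hab => hab)

lemma coe_par_inducedGraph (v : W) : ((par (TreeShift.inducedGraph G W) v : W) : V) = par G v := by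
  by_cases h : IsRoot G v
  · rw [par_eq_self_of_isRoot h, par_eq_self_of_isRoot ((isRoot_inducedGraph_iff hW).2 h)]
  · have hadj := adj_par_of_not_isRoot (mt (isRoot_inducedGraph_iff hW).1 h)
    exact (hG.par_eq hadj).symm

lemma hasRoot_inducedGraph_iff (hne : W.Nonempty) :
    HasRoot (TreeShift.inducedGraph G W) ↔ HasRoot G := by
  constructor
  · rintro ⟨r, hr⟩
    exact ⟨r, (isRoot_inducedGraph_iff hW).1 hr⟩
  · rintro ⟨r, hr⟩
    obtain ⟨v, hv⟩ := hne
    obtain ⟨n, hn⟩ := hG.exists_iterate_par_eq_root hr v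
    exact ⟨⟨r, hn ▸ hW.iterate n hv⟩, (isRoot_inducedGraph_iff hW).2 hr⟩

end IsDirectedTree

end InducedGraph

end Tree

section Ell2

variable {ι : Type*}

open Classical in
lemma basisVec_apply (i j : ι) : (basisVec i : Ell2 ι) j = if j = i then 1 else 0 := by
  rw [basisVec, lp.single_apply, Pi.single_apply]

lemma inner_basisVec_left (i : ι) (f : Ell2 ι) : inner ℂ (basisVec i) f = f i := by
  classical
  simpa [basisVec] using lp.inner_single_left (𝕜 := ℂ) i (1 : ℂ) f

lemma norm_basisVec (i : ι) : ‖(basisVec i : Ell2 ι)‖ = 1 := by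
  classical
  rw [basisVec, lp.norm_single (by norm_num), norm_one]

lemma hasSum_norm_sq (f : Ell2 ι) : HasSum (fun i => ‖f i‖ ^ 2) (‖f‖ ^ 2) := by
  simpa using lp.hasSum_norm (p := 2) (by norm_num) f

variable {W : Set ι}

lemma mem_orthogonal_span_iff {𝕜 E : Type*} [RCLike 𝕜] [NormedAddCommGroup E]
    [InnerProductSpace 𝕜 E] {s : Set E} {x : E} :
    x ∈ (Submodule.span 𝕜 s)ᗮ ↔ ∀ u ∈ s, inner 𝕜 u x = 0 := by
  refine ⟨fun h u hu => (Submodule.mem_orthogonal _ x).1 h u (Submodule.subset_span hu),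
    fun h => (Submodule.mem_orthogonal _ x).2 fun u hu => ?_⟩
  have hle : Submodule.span 𝕜 s ≤ (Submodule.span 𝕜 {x})ᗮ := Submodule.span_le.2 fun u hu =>
    Submodule.mem_orthogonal_singleton_iff_inner_left.2 (h u hu)
  exact Submodule.mem_orthogonal_singleton_iff_inner_left.1 (hle hu)

lemma mem_orthogonal_span_basisVec {f : Ell2 ι} :
    f ∈ (Submodule.span ℂ (basisVec '' W))ᗮ ↔ ∀ i ∈ W, f i = 0 := by
  simp only [mem_orthogonal_span_iff, Set.forall_mem_image, inner_basisVec_left]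

lemma mem_ell2Sub {f : Ell2 ι} : f ∈ ell2Sub W ↔ ∀ i ∉ W, f i = 0 := by
  rw [ell2Sub, ← Submodule.orthogonal_orthogonal_eq_closure, Submodule.mem_orthogonal]
  simp only [mem_orthogonal_span_basisVec]
  constructor
  · intro hf i hi
    rw [← inner_basisVec_left]
    exact hf _ fun j hj => by rw [basisVec_apply, if_neg (ne_of_mem_of_not_mem hj hi)]
  · intro hf g hg
    rw [lp.inner_eq_tsum]
    refine (tsum_congr fun i => ?_).trans tsum_zero
    by_cases hi : i ∈ W
    · rw [hg i hi, inner_zero_left]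
    · rw [hf i hi, inner_zero_right]

lemma ell2Sub_orthogonal (W : Set ι) : (ell2Sub W)ᗮ = ell2Sub Wᶜ := by
  ext f
  rw [ell2Sub, Submodule.orthogonal_closure, mem_orthogonal_span_basisVec, mem_ell2Sub]
  simp only [Set.notMem_compl_iff]

lemma range_ell2Incl (W : Set ι) : LinearMap.range (ell2Incl W).toLinearMap = ell2Sub W := by
  ext f
  rw [mem_ell2Sub]
  constructor
  · rintro ⟨g, rfl⟩ i hi
    exact ell2Map_apply_of_notMem _ _ g i fun ⟨w, hw⟩ => hi (hw ▸ w.2)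
  · intro hf
    have hmem : Memℓp (fun w : W => f w) 2 :=
      memℓp_gen (((lp.memℓp f).summable (by norm_num)).comp_injective Subtype.val_injective)
    refine ⟨⟨_, hmem⟩, lp.ext (funext fun i => ?_)⟩
    by_cases hi : i ∈ W
    · exact ell2Map_apply _ Subtype.val_injective _ (⟨i, hi⟩ : W)
    · exact (ell2Map_apply_of_notMem _ _ _ i fun ⟨w, hw⟩ => hi (hw ▸ w.2)).trans (hf i hi).symm

end Ell2

section ShiftCoordinates

variable {V : Type*} (G : Digraph V)

open Classical in
/-- The weights `lam`, with the irrelevant value at a root replaced by `0`. With these weights the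
coordinate formula `weightedShift_coord` needs no case distinction, since `par G r = r` at a
root `r`. -/
noncomputable def effWeight (lam : V → ℝ) (v : V) : ℝ := if IsRoot G v then 0 else lam v

variable {G} {lam : V → ℝ}

lemma effWeight_of_isRoot {v : V} (hv : IsRoot G v) : effWeight G lam v = 0 := if_pos hv

lemma effWeight_of_not_isRoot {v : V} (hv : ¬ IsRoot G v) : effWeight G lam v = lam v := if_neg hv

variable (hb : BoundedWeights G lam)

lemma weightedShift_coord (f : Ell2 V) (v : V) :
    weightedShift G lam hb f v = (effWeight G lam v : ℂ) * f (par G v) := by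
  rw [weightedShift_apply, shiftFun]
  by_cases hv : IsRoot G v
  · rw [if_neg (fun h => not_isRoot_iff.2 h hv), effWeight_of_isRoot hv, Complex.ofReal_zero,
      zero_mul]
  · rw [if_pos (not_isRoot_iff.1 hv), effWeight_of_not_isRoot hv]

lemma weightedShift_pow_coord (n : ℕ) (f : Ell2 V) (v : V) :
    (weightedShift G lam hb ^ n) f v =
      ((∏ j ∈ Finset.range n, effWeight G lam ((par G)^[j] v) : ℝ) : ℂ) * f ((par G)^[n] v) := by
  induction n generalizing v with
  | zero => simp
  | succ n ih =>
    rw [pow_succ', mul_apply_eq_comp, weightedShift_coord, ih, Finset.prod_range_succ']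
    simp only [Function.iterate_succ_apply, Function.iterate_zero_apply, Complex.ofReal_mul]
    ring

end ShiftCoordinates

section Asymptote

variable {H : Type*} [NormedAddCommGroup H] [InnerProductSpace ℂ H] [CompleteSpace H]

lemma sqrt_apply_of_eigenvector {A : H →L[ℂ] H} (hA : 0 ≤ A) {a : ℝ} (ha : 0 ≤ a) {e : H}
    (he : A e = (a : ℂ) • e) : CFC.sqrt A e = (√a : ℂ) • e := by
  set B := CFC.sqrt A with hB
  set y := B e - (√a : ℂ) • e with hy
  have hBy : B y = -((√a : ℂ) • y) := by
    have hBB : B (B e) = A e := DFunLike.congr_fun (CFC.sqrt_mul_sqrt_self A hA) e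
    have hsq : (√a : ℂ) * √a = a := by rw [← Complex.ofReal_mul, Real.mul_self_sqrt ha]
    rw [hy, map_sub, hBB, he, map_smul, smul_sub, smul_smul, hsq, neg_sub]
  have hsy : √a * ‖y‖ ^ 2 = 0 := by
    have hpos : 0 ≤ (inner ℂ (B y) y).re :=
      ((ContinuousLinearMap.nonneg_iff_isPositive _).1 (CFC.sqrt_nonneg A)).re_inner_nonneg_left y
    rw [hBy, inner_neg_left, inner_smul_left, Complex.conj_ofReal, Complex.neg_re,
      Complex.re_ofReal_mul, ← RCLike.re_eq_complex_re, inner_self_eq_norm_sq,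
      Left.nonneg_neg_iff] at hpos
    exact hpos.antisymm (by positivity)
  have hsmul : (√a : ℂ) • y = 0 := by simpa [or_comm] using hsy
  have hyy : inner ℂ y y = 0 := by
    nth_rewrite 2 [hy]
    rw [inner_sub_right, hB, ← sqrt_selfAdjoint, ← hB, hBy, hsmul, inner_smul_right,
      neg_zero, inner_zero_left, ← Complex.conj_ofReal, ← inner_smul_left, hsmul,
      inner_zero_left, sub_zero]
  exact sub_eq_zero.1 (inner_self_eq_zero.1 hyy)

lemma isometricAsymptote_eq {T : H →L[ℂ] H} (hT : ‖T‖ ≤ 1)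
    {L : (stableSubspace T)ᗮ →L[ℂ] (stableSubspace T)ᗮ}
    (hL : ∀ x, asymptoteMap T hT (T x) = L (asymptoteMap T hT x)) :
    (isometricAsymptote T hT).toContinuousLinearMap = L := by
  refine DFunLike.coe_injective ((asymptoteMap_denseRange T hT).equalizer
    (ContinuousLinearMap.continuous _) L.continuous (funext fun x => ?_))
  exact (isometricAsymptote_spec T hT x).symm.trans (hL x)

end Asymptote

section Core

variable {V : Type*} {G : Digraph V} {lam : V → ℝ} {hb : BoundedWeights G lam}

section
variable (hG : IsDirectedTree G)
include hG

lemma weightedShift_basisVec_apply (u v : V) :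
    weightedShift G lam hb (basisVec u) v = ((chi G u).indicator lam v : ℝ) := by
  classical
  rw [weightedShift_coord, basisVec_apply, Set.indicator_apply]
  by_cases hr : IsRoot G v
  · rw [effWeight_of_isRoot hr, if_neg (show v ∉ chi G u from hr u), Complex.ofReal_zero, zero_mul]
  · have hiff : par G v = u ↔ v ∈ chi G u :=
      ⟨fun h => h ▸ adj_par_of_not_isRoot hr, hG.par_eq⟩
    rw [effWeight_of_not_isRoot hr]
    simp only [hiff, mul_ite, mul_one, mul_zero, apply_ite Complex.ofReal, Complex.ofReal_zero]

lemma weightedShift_pow_basisVec_apply (n : ℕ) (u v : V) :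
    (weightedShift G lam hb ^ n) (basisVec u) v =
      ((chiPow G n u).indicator (fun v => ∏ j ∈ Finset.range n, lam ((par G)^[j] v)) v : ℝ) := by
  classical
  rw [weightedShift_pow_coord, basisVec_apply, Set.indicator_apply, hG.mem_chiPow]
  simp only [effWeight, ← ite_not (IsRoot G _), Finset.prod_ite_zero, Finset.mem_range]
  by_cases hu : (par G)^[n] v = u <;> simp [hu]

lemma hasSum_alphaSum (hb : BoundedWeights G lam) (n : ℕ) (u : V) :
    HasSum (fun v : chiPow G n u => ∏ j ∈ Finset.range n, lam ((par G)^[j] v) ^ 2)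
      (‖(weightedShift G lam hb ^ n) (basisVec u)‖ ^ 2) := by
  rw [← Function.comp_def (fun v => ∏ j ∈ Finset.range n, lam ((par G)^[j] v) ^ 2),
    hasSum_subtype_iff_indicator]
  refine (hasSum_norm_sq _).congr_fun fun v => ?_
  rw [weightedShift_pow_basisVec_apply hG, Complex.norm_real, Real.norm_eq_abs, sq_abs]
  by_cases hv : v ∈ chiPow G n u
  · simp only [Set.indicator_of_mem hv, Finset.prod_pow]
  · simp only [Set.indicator_of_notMem hv, zero_pow two_ne_zero]

lemma alphaSum_eq (hb : BoundedWeights G lam) (n : ℕ) (u : V) :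
    alphaSum G lam n u = ‖(weightedShift G lam hb ^ n) (basisVec u)‖ ^ 2 :=
  (hasSum_alphaSum hG hb n u).tsum_eq

omit hG in
lemma inner_pow_basisVec_of_ne (n : ℕ) {u w : V} (h : u ≠ w) :
    inner ℂ ((weightedShift G lam hb ^ n) (basisVec u))
      ((weightedShift G lam hb ^ n) (basisVec w)) = 0 := by
  rw [lp.inner_eq_tsum]
  refine (tsum_congr fun v => ?_).trans tsum_zero
  rw [weightedShift_pow_coord, weightedShift_pow_coord, basisVec_apply, basisVec_apply]
  split_ifs with hu hw
  · exact absurd (hu.symm.trans hw) h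
  · rw [mul_zero, inner_zero_right]
  · rw [mul_zero, inner_zero_left]
  · rw [mul_zero, inner_zero_left]

lemma gram_pow_basisVec (n : ℕ) (u : V) :
    ((ContinuousLinearMap.adjoint (weightedShift G lam hb)) ^ n)
      ((weightedShift G lam hb ^ n) (basisVec u)) = (alphaSum G lam n u : ℂ) • basisVec u := by
  ext w
  rw [← inner_basisVec_left w (((ContinuousLinearMap.adjoint _) ^ n) _), adjoint_pow',
    ContinuousLinearMap.adjoint_inner_right, lp.coeFn_smul, Pi.smul_apply, basisVec_apply]
  split_ifs with h
  · rw [h, inner_self_eq_norm_sq_to_K, alphaSum_eq hG hb]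
    simp
  · rw [inner_pow_basisVec_of_ne n h, smul_zero]

section
variable (hc : ‖weightedShift G lam hb‖ ≤ 1)
include hc

lemma tendsto_alphaSum (u : V) :
    Tendsto (fun n => alphaSum G lam n u) atTop (𝓝 (alpha G lam u)) := by
  refine tendsto_nhds_limUnder ⟨_, (tendsto_norm_sq_orbit_re _ hc (basisVec u)).congr fun n => ?_⟩
  rw [alphaSum_eq hG hb]

lemma alpha_nonneg (u : V) : 0 ≤ alpha G lam u :=
  ge_of_tendsto' (tendsto_alphaSum hG hc u) fun n => by rw [alphaSum_eq hG hb]; positivity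

lemma asymptoticLimit_basisVec (u : V) :
    asymptoticLimit (weightedShift G lam hb) hc (basisVec u) =
      (alpha G lam u : ℂ) • basisVec u := by
  refine tendsto_nhds_unique (asymptoticLimit_spec _ hc (basisVec u)) ?_
  simp only [gram_pow_basisVec hG]
  exact ((Complex.continuous_ofReal.tendsto _).comp (tendsto_alphaSum hG hc u)).smul_const _

lemma coe_asymptoteMap_basisVec (u : V) :
    (asymptoteMap (weightedShift G lam hb) hc (basisVec u) : Ell2 V) =
      (√(alpha G lam u) : ℂ) • basisVec u :=
  sqrt_apply_of_eigenvector (asymptoticLimit_nonneg _ hc) (alpha_nonneg hG hc u)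
    (asymptoticLimit_basisVec hG hc u)

lemma asymptoteMap_coord (f : Ell2 V) (u : V) :
    (asymptoteMap (weightedShift G lam hb) hc f : Ell2 V) u = (√(alpha G lam u) : ℂ) * f u := by
  have hself := sqrt_selfAdjoint (asymptoticLimit (weightedShift G lam hb) hc) (basisVec u) f
  rw [← inner_basisVec_left, ← inner_basisVec_left u f, ← Complex.conj_ofReal, ← inner_smul_left,
    ← coe_asymptoteMap_basisVec hG hc]
  exact hself.symm

lemma mem_stableSubspace_iff_coord {f : Ell2 V} :
    f ∈ stableSubspace (weightedShift G lam hb) ↔ ∀ u, 0 < alpha G lam u → f u = 0 := by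
  have hcoord (u : V) : (asymptoteMap (weightedShift G lam hb) hc f : Ell2 V) u = 0 ↔
      (0 < alpha G lam u → f u = 0) := by
    rw [asymptoteMap_coord hG hc, mul_eq_zero, Complex.ofReal_eq_zero,
      Real.sqrt_eq_zero', ← not_lt, imp_iff_not_or]
  rw [mem_stableSubspace_iff _ hc, ← forall_congr' hcoord]
  exact lp.ext_iff.trans funext_iff

lemma mem_coreSet_iff {v : V} : v ∈ coreSet G lam hb ↔ 0 < alpha G lam v := by
  have hmem : v ∈ coreSet G lam hb ↔ ∀ f ∈ stableSubspace (weightedShift G lam hb), f v = 0 := by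
    simp only [coreSet, Set.mem_ofPred_eq, Submodule.mem_orthogonal', inner_basisVec_left]
  simp only [hmem, mem_stableSubspace_iff_coord hG hc]
  refine ⟨fun h => ?_, fun h f hf => hf v h⟩
  by_contra h0
  have hv := h (basisVec v) fun u hu => by
    rw [basisVec_apply, if_neg (ne_of_mem_of_not_mem (s := {u | 0 < alpha G lam u}) hu h0)]
  rw [basisVec_apply, if_pos rfl] at hv
  exact one_ne_zero hv

lemma stableSubspace_eq :
    stableSubspace (weightedShift G lam hb) = ell2Sub (coreSet G lam hb)ᶜ := by
  ext f
  simp only [mem_ell2Sub, mem_stableSubspace_iff_coord hG hc, Set.mem_compl_iff, not_not,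
    mem_coreSet_iff hG hc]

lemma stableSubspace_orthogonal_eq :
    (stableSubspace (weightedShift G lam hb))ᗮ = ell2Sub (coreSet G lam hb) := by
  rw [stableSubspace_eq hG hc, ell2Sub_orthogonal, compl_compl]

lemma coreSet_nonempty (hns : ¬ IsStable (weightedShift G lam hb)) :
    (coreSet G lam hb).Nonempty := by
  contrapose! hns
  ext f
  simp [stableSubspace_eq hG hc, hns, mem_ell2Sub]

lemma hasSum_alpha (u : V) :
    HasSum (fun v : chi G u => lam v ^ 2 * alpha G lam v) (alpha G lam u) := by
  have hnorm : ‖(asymptoteMap _ hc (weightedShift G lam hb (basisVec u)) : Ell2 V)‖ ^ 2 =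
      alpha G lam u := by
    rw [← Submodule.coe_norm, asymptoteMap_norm_comp, Submodule.coe_norm,
      coe_asymptoteMap_basisVec hG hc, norm_smul, norm_basisVec, mul_one, Complex.norm_real,
      Real.norm_eq_abs, sq_abs, Real.sq_sqrt (alpha_nonneg hG hc u)]
  rw [← Function.comp_def (fun v => lam v ^ 2 * alpha G lam v), hasSum_subtype_iff_indicator,
    ← hnorm]
  refine (hasSum_norm_sq _).congr_fun fun v => ?_
  rw [asymptoteMap_coord hG hc, weightedShift_basisVec_apply hG, ← Complex.ofReal_mul,
    Complex.norm_real, Real.norm_eq_abs, sq_abs, mul_pow, Real.sq_sqrt (alpha_nonneg hG hc v),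
    mul_comm]
  by_cases hv : v ∈ chi G u
  · simp only [Set.indicator_of_mem hv]
  · simp only [Set.indicator_of_notMem hv, zero_pow two_ne_zero, zero_mul]

end

end

end Core

section CoreTree

variable {V : Type*} {G : Digraph V} {lam : V → ℝ}

lemma hasSum_chi_inducedGraph_iff {W : Set V} {f : V → ℝ} {a : ℝ} (u : W) (hf : ∀ v ∉ W, f v = 0) :
    HasSum (fun v : chi (inducedGraph G W) u => f v) a ↔ HasSum (fun v : chi G u => f v) a := by
  let incl (v : chi (inducedGraph G W) u) : chi G u := ⟨v, v.2⟩
  have hincl : Function.Injective incl := fun v w h =>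
    Subtype.ext (Subtype.ext (congrArg (fun x : chi G u => (x : V)) h))
  refine hincl.hasSum_iff (f := fun v : chi G u => f v) fun v hv => hf v fun hvW => hv ?_
  exact ⟨⟨⟨v, hvW⟩, v.2⟩, rfl⟩

lemma boundedWeights_of_hasSum_one
    (h : ∀ u, HasSum (fun v : chi G u => |lam v| ^ 2) 1) : BoundedWeights G lam := by
  refine ⟨fun u => (h u).summable, 1, ?_⟩
  rintro _ ⟨u, rfl⟩
  exact (congrArg Real.sqrt (h u).tsum_eq).trans_le Real.sqrt_one.le

lemma isLeafless_of_hasSum_one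
    (h : ∀ u, HasSum (fun v : chi G u => |lam v| ^ 2) 1) : IsLeafless G := by
  refine fun u => Set.nonempty_iff_ne_empty.2 fun hu => ?_
  have := Set.isEmpty_coe_sort.2 hu
  exact one_ne_zero ((h u).unique hasSum_empty)

variable {hb : BoundedWeights G lam} (hG : IsDirectedTree G) (hc : ‖weightedShift G lam hb‖ ≤ 1)
include hG hc

section
variable (hne : ∀ u v, G.Adj u v → lam v ≠ 0)
include hne

lemma mapsTo_par_coreSet : Set.MapsTo (par G) (coreSet G lam hb) (coreSet G lam hb) := by
  intro v hv
  by_cases hr : IsRoot G v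
  · rwa [par_eq_self_of_isRoot hr]
  rw [mem_coreSet_iff hG hc] at hv ⊢
  have hadj := adj_par_of_not_isRoot hr
  have hle : lam v ^ 2 * alpha G lam v ≤ alpha G lam (par G v) :=
    le_hasSum (hasSum_alpha hG hc (par G v)) ⟨v, hadj⟩ fun w _ =>
      mul_nonneg (sq_nonneg _) (alpha_nonneg hG hc w)
  exact (mul_pos (pow_pos (abs_pos.2 (hne _ _ hadj)) 2 |>.trans_eq (sq_abs _)) hv).trans_le hle

lemma isDirectedTree_coreTree : IsDirectedTree (coreTree G lam hb) :=
  hG.inducedGraph (mapsTo_par_coreSet hG hc hne)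

end

lemma abs_coreWeight_sq (v : coreSet G lam hb) :
    |coreWeight G lam hb v| ^ 2 = lam v ^ 2 * alpha G lam v / alpha G lam (par G v) := by
  rw [sq_abs, coreWeight, div_pow, mul_pow, Real.sq_sqrt (alpha_nonneg hG hc _),
    Real.sq_sqrt (alpha_nonneg hG hc _)]

lemma hasSum_coreWeight_sq (u : coreSet G lam hb) :
    HasSum (fun v : chi (coreTree G lam hb) u => |coreWeight G lam hb v| ^ 2) 1 := by
  have hpos := (mem_coreSet_iff hG hc).1 u.2
  have hzero (v) (hv : v ∉ coreSet G lam hb) : lam v ^ 2 * alpha G lam v = 0 := by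
    have hle := not_lt.1 (mt (mem_coreSet_iff hG hc).2 hv)
    rw [hle.antisymm (alpha_nonneg hG hc v), mul_zero]
  have hsum := (hasSum_chi_inducedGraph_iff u hzero).2 (hasSum_alpha hG hc u)
  have hdiv := hsum.div_const (alpha G lam u)
  rw [div_self hpos.ne'] at hdiv
  refine hdiv.congr_fun fun v : chi (inducedGraph G (coreSet G lam hb)) u => ?_
  rw [abs_coreWeight_sq hG hc, hG.par_eq (show G.Adj u v from v.2)]

lemma coreWeight_pos (hpos : ∀ u v, G.Adj u v → 0 < lam v) (u v : coreSet G lam hb)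
    (h : (coreTree G lam hb).Adj u v) : 0 < coreWeight G lam hb v := by
  have hu := (mem_coreSet_iff hG hc).1 u.2
  have hv := (mem_coreSet_iff hG hc).1 v.2
  rw [coreWeight, hG.par_eq (show G.Adj u v from h)]
  exact div_pos (mul_pos (hpos u v h) (Real.sqrt_pos.2 hv)) (Real.sqrt_pos.2 hu)

omit hc in
/-- The identification of `ℓ²(V')` with the orthocomplement of the stable subspace, given by
extension by zero. -/
noncomputable def coreEquiv (hG : IsDirectedTree G) (hc : ‖weightedShift G lam hb‖ ≤ 1) :
    Ell2 (coreSet G lam hb) ≃ₗᵢ[ℂ] (stableSubspace (weightedShift G lam hb))ᗮ :=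
  (ell2Incl (coreSet G lam hb)).equivRange.trans (LinearIsometryEquiv.ofEq _ _
    ((range_ell2Incl _).trans (stableSubspace_orthogonal_eq hG hc).symm))

omit hG hc in
lemma coe_coreEquiv (hG : IsDirectedTree G) (hc : ‖weightedShift G lam hb‖ ≤ 1)
    (f : Ell2 (coreSet G lam hb)) :
    (coreEquiv hG hc f : Ell2 V) = ell2Incl (coreSet G lam hb) f := rfl

lemma coreEquiv_apply_coe (f : Ell2 (coreSet G lam hb)) (v : coreSet G lam hb) :
    (coreEquiv hG hc f : Ell2 V) v = f v :=
  ell2Map_apply _ Subtype.val_injective f v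

lemma effWeight_coreWeight_mul_sqrt_alpha (hne : ∀ u v, G.Adj u v → lam v ≠ 0)
    (v : coreSet G lam hb) :
    effWeight (coreTree G lam hb) (coreWeight G lam hb) v * √(alpha G lam (par G v)) =
      √(alpha G lam v) * effWeight G lam v := by
  have hroot : IsRoot (coreTree G lam hb) v ↔ IsRoot G v :=
    isRoot_inducedGraph_iff (mapsTo_par_coreSet hG hc hne)
  by_cases hr : IsRoot G v
  · rw [effWeight_of_isRoot hr, effWeight_of_isRoot (hroot.2 hr), zero_mul,
      mul_zero]
  · have hpos := (mem_coreSet_iff hG hc).1 (mapsTo_par_coreSet hG hc hne v.2)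
    rw [effWeight_of_not_isRoot hr, effWeight_of_not_isRoot (mt hroot.1 hr),
      coreWeight, div_mul_cancel₀ _ (Real.sqrt_pos.2 hpos).ne', mul_comm]

lemma isometricAsymptote_coreEquiv (hne : ∀ u v, G.Adj u v → lam v ≠ 0)
    (hβ : BoundedWeights (coreTree G lam hb) (coreWeight G lam hb)) (f : Ell2 (coreSet G lam hb)) :
    isometricAsymptote (weightedShift G lam hb) hc (coreEquiv hG hc f) =
      coreEquiv hG hc (weightedShift (coreTree G lam hb) (coreWeight G lam hb) hβ f) := by
  set J := coreEquiv hG hc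
  set Sβ := weightedShift (coreTree G lam hb) (coreWeight G lam hb) hβ
  let L : (stableSubspace (weightedShift G lam hb))ᗮ →L[ℂ] _ :=
    J.toContinuousLinearEquiv.toContinuousLinearMap ∘L Sβ ∘L
      J.symm.toContinuousLinearEquiv.toContinuousLinearMap
  have eq_of_coord {x y : (stableSubspace (weightedShift G lam hb))ᗮ}
      (h : ∀ v : coreSet G lam hb, (x : Ell2 V) v = (y : Ell2 V) v) : x = y := by
    obtain ⟨a, rfl⟩ := J.surjective x
    obtain ⟨b, rfl⟩ := J.surjective y
    refine congrArg J (lp.ext (funext fun v => ?_))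
    rw [← coreEquiv_apply_coe hG hc a, ← coreEquiv_apply_coe hG hc b, h]
  have hL (x) : asymptoteMap _ hc (weightedShift G lam hb x) = L (asymptoteMap _ hc x) := by
    obtain ⟨g, hg⟩ := J.surjective (asymptoteMap _ hc x)
    refine eq_of_coord fun v => ?_
    have hLg : L (asymptoteMap _ hc x) = J (Sβ g) := by
      rw [← hg]
      exact congrArg (J ∘ Sβ) (J.symm_apply_apply g)
    rw [hLg, coreEquiv_apply_coe, weightedShift_coord, asymptoteMap_coord hG hc,
      weightedShift_coord, ← coreEquiv_apply_coe hG hc g, hg, asymptoteMap_coord hG hc,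
      coreTree, hG.coe_par_inducedGraph (mapsTo_par_coreSet hG hc hne), ← mul_assoc, ← mul_assoc,
      ← Complex.ofReal_mul, ← Complex.ofReal_mul, ← effWeight_coreWeight_mul_sqrt_alpha hG hc hne]
    rfl
  rw [← LinearIsometry.coe_toContinuousLinearMap, isometricAsymptote_eq hc hL]
  exact congrArg (J ∘ Sβ) (J.symm_apply_apply f)

end CoreTree

lemma exists_hilbertBasis_of_total {𝕜 E ι : Type*} [RCLike 𝕜] [NormedAddCommGroup E]
    [InnerProductSpace 𝕜 E] [CompleteSpace E] {v : ι → E} (hv : Orthonormal 𝕜 v)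
    (h : ∀ x, (∀ i, inner 𝕜 (v i) x = 0) → x = 0) : ∃ b : HilbertBasis ι 𝕜 E, ⇑b = v := by
  have hbot : (Submodule.span 𝕜 (Set.range v))ᗮ = ⊥ := (Submodule.eq_bot_iff _).2 fun x hx =>
    h x fun i => mem_orthogonal_span_iff.1 hx _ (Set.mem_range_self i)
  exact ⟨.mkOfOrthogonalEqBot hv hbot, HilbertBasis.coe_mkOfOrthogonalEqBot hv hbot⟩

lemma eq_zero_of_inner_hilbertBasis {𝕜 E ι : Type*} [RCLike 𝕜] [NormedAddCommGroup E]
    [InnerProductSpace 𝕜 E] (b : HilbertBasis ι 𝕜 E) {x : E} (h : ∀ i, inner 𝕜 (b i) x = 0) :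
    x = 0 :=
  b.repr.injective (lp.ext (funext fun i => by rw [b.repr_apply_apply, h, map_zero]; rfl))

section UnitaryEquivalence

variable {H K L : Type*} [NormedAddCommGroup H] [InnerProductSpace ℂ H]
  [NormedAddCommGroup K] [InnerProductSpace ℂ K] [NormedAddCommGroup L] [InnerProductSpace ℂ L]
  {T : H →L[ℂ] H} {T' : K →L[ℂ] K} {T'' : L →L[ℂ] L}

lemma UnitarilyEquivalent.symm : UnitarilyEquivalent T T' → UnitarilyEquivalent T' T
  | ⟨W, hW⟩ => ⟨W.symm, fun x => by rw [W.symm_apply_eq, hW, W.apply_symm_apply]⟩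

lemma UnitarilyEquivalent.trans : UnitarilyEquivalent T T' → UnitarilyEquivalent T' T'' →
    UnitarilyEquivalent T T''
  | ⟨W, hW⟩, ⟨W', hW'⟩ => ⟨W.trans W', fun x => by
      rw [LinearIsometryEquiv.trans_apply, hW, hW', LinearIsometryEquiv.trans_apply]⟩

lemma UnitarilyEquivalent.of_hilbertBasis {ι : Type*} (b : HilbertBasis ι ℂ H)
    (b' : HilbertBasis ι ℂ K) (σ : ι → ι) (hT : ∀ i, T (b i) = b (σ i))
    (hT' : ∀ i, T' (b' i) = b' (σ i)) : UnitarilyEquivalent T T' := by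
  classical
  let W := b.repr.trans b'.repr.symm
  have hW (i : ι) : W (b i) = b' i := by
    rw [LinearIsometryEquiv.trans_apply, b.repr_self, b'.repr_symm_single]
  have hcomp : W.toContinuousLinearEquiv.toContinuousLinearMap ∘L T =
      T' ∘L W.toContinuousLinearEquiv.toContinuousLinearMap := by
    refine ContinuousLinearMap.ext_on
      (Submodule.dense_iff_topologicalClosure_eq_top.2 b.dense_span) ?_
    rintro _ ⟨i, rfl⟩
    change W (T (b i)) = T' (W (b i))
    rw [hT, hW, hW, hT']
  exact ⟨W, DFunLike.congr_fun hcomp⟩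

variable [CompleteSpace H] [CompleteSpace K]

lemma UnitarilyEquivalent.isCNU (h : UnitarilyEquivalent T T') (hT : IsCNU T) : IsCNU T' := by
  obtain ⟨W, hW⟩ := h
  have hW' (x : H) :
      W (ContinuousLinearMap.adjoint T x) = ContinuousLinearMap.adjoint T' (W x) := by
    refine ext_inner_right ℂ fun y => ?_
    obtain ⟨z, rfl⟩ := W.surjective y
    rw [W.inner_map_map, ContinuousLinearMap.adjoint_inner_left,
      ContinuousLinearMap.adjoint_inner_left, ← hW, W.inner_map_map]
  intro M hM hinv hadj hnorm hsurj
  have hbot := hT (M.comap W.toLinearEquiv.toLinearMap) (hM.preimage W.continuous)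
    (fun x hx => by simpa [hW] using hinv _ hx) (fun x hx => by simpa [hW'] using hadj _ hx)
    (fun x hx => by rw [← W.norm_map, hW, ← W.norm_map x]; exact hnorm _ hx) fun y hy => by
      obtain ⟨x, hx, hxy⟩ := hsurj _ hy
      refine ⟨W.symm x, by simpa using hx, W.injective ?_⟩
      rw [hW, W.apply_symm_apply]
      exact hxy
  rw [Submodule.eq_bot_iff] at hbot ⊢
  exact fun x hx => W.symm.map_eq_zero_iff.1 (hbot (W.symm x) (by simpa using hx))

lemma UnitarilyEquivalent.isCNU_iff (h : UnitarilyEquivalent T T') : IsCNU T ↔ IsCNU T' :=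
  ⟨h.isCNU, h.symm.isCNU⟩

end UnitaryEquivalence

section Models

lemma ell2Map_basisVec {ι κ : Type*} {φ : ι → κ} (hφ : Function.Injective φ) (i : ι) :
    ell2Map φ hφ (basisVec i) = basisVec (φ i) := by
  classical
  refine lp.ext (funext fun k => ?_)
  rw [basisVec_apply]
  by_cases h : ∃ j, φ j = k
  · obtain ⟨j, rfl⟩ := h
    rw [ell2Map_apply, basisVec_apply]
    exact if_congr hφ.eq_iff.symm rfl rfl
  · rw [ell2Map_apply_of_notMem _ _ _ _ h, if_neg fun hk => h ⟨i, hk.symm⟩]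

lemma exists_hilbertBasis_basisVec (ι : Type*) :
    ∃ b : HilbertBasis ι ℂ (Ell2 ι), ⇑b = basisVec := by
  refine exists_hilbertBasis_of_total ⟨norm_basisVec, fun i j h => ?_⟩ fun f hf => ?_
  · change inner ℂ (basisVec i) (basisVec j) = 0
    rw [inner_basisVec_left, basisVec_apply, if_neg h]
  · exact lp.ext (funext fun i => (inner_basisVec_left i f).symm.trans (hf i))

lemma exists_hilbertBasis_unilateralShiftMult (n : ℕ∞) :
    ∃ b : HilbertBasis (IndexSet n × ℕ) ℂ (Ell2Copies n),
      ∀ i k, unilateralShiftMult n (b (i, k)) = b (i, k + 1) := by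
  let v (p : IndexSet n × ℕ) : Ell2Copies n := lp.single 2 p.1 (basisVec p.2)
  have inner_v (p : IndexSet n × ℕ) (f : Ell2Copies n) : inner ℂ (v p) f = f p.1 p.2 := by
    rw [lp.inner_single_left, inner_basisVec_left]
  have v_apply_self (i : IndexSet n) (k : ℕ) : v (i, k) i = basisVec k := by
    rw [lp.single_apply, Pi.single_eq_same]
  have v_apply_of_ne {i j : IndexSet n} (k : ℕ) (h : j ≠ i) : v (i, k) j = 0 := by
    rw [lp.single_apply, Pi.single_eq_of_ne h]
  have orthonormal_v : Orthonormal ℂ v := by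
    refine ⟨fun p => by rw [lp.norm_single (by norm_num), norm_basisVec], ?_⟩
    rintro ⟨i, k⟩ ⟨j, l⟩ h
    change inner ℂ (v (i, k)) (v (j, l)) = 0
    rw [inner_v]
    by_cases hij : i = j
    · subst hij
      rw [v_apply_self, basisVec_apply, if_neg fun hkl => h (Prod.ext rfl hkl)]
    · rw [v_apply_of_ne _ hij]
      rfl
  obtain ⟨b, hb⟩ := exists_hilbertBasis_of_total orthonormal_v fun f hf =>
    lp.ext (funext fun i => lp.ext (funext fun k => (inner_v (i, k) f).symm.trans (hf (i, k))))
  refine ⟨b, fun i k => lp.ext (funext fun j => ?_)⟩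
  rw [hb]
  change unilateralShift (v (i, k) j) = v (i, k + 1) j
  by_cases hij : j = i
  · subst hij
    rw [v_apply_self, v_apply_self, unilateralShift, ell2Map_basisVec]
  · rw [v_apply_of_ne _ hij, v_apply_of_ne _ hij, map_zero]

lemma exists_hilbertBasis_withLp_prod {𝕜 E F ι κ : Type*} [RCLike 𝕜] [NormedAddCommGroup E]
    [InnerProductSpace 𝕜 E] [CompleteSpace E] [NormedAddCommGroup F] [InnerProductSpace 𝕜 F]
    [CompleteSpace F] (a : HilbertBasis ι 𝕜 E) (b : HilbertBasis κ 𝕜 F) :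
    ∃ c : HilbertBasis (ι ⊕ κ) 𝕜 (WithLp 2 (E × F)),
      (∀ i, c (.inl i) = WithLp.toLp 2 (a i, 0)) ∧ ∀ j, c (.inr j) = WithLp.toLp 2 (0, b j) := by
  classical
  let v : ι ⊕ κ → WithLp 2 (E × F) :=
    Sum.elim (fun i => WithLp.toLp 2 (a i, 0)) (fun j => WithLp.toLp 2 (0, b j))
  have hv : Orthonormal 𝕜 v := by
    rw [orthonormal_iff_ite]
    have ha := orthonormal_iff_ite.1 a.orthonormal
    have hb := orthonormal_iff_ite.1 b.orthonormal
    rintro (i | i) (j | j) <;> simp [v, WithLp.prod_inner_apply, ha, hb]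
  obtain ⟨c, hc⟩ := exists_hilbertBasis_of_total hv fun x hx => by
    refine WithLp.ofLp_injective 2 (Prod.ext ?_ ?_)
    · exact eq_zero_of_inner_hilbertBasis a fun i => by
        simpa [v, WithLp.prod_inner_apply] using hx (.inl i)
    · exact eq_zero_of_inner_hilbertBasis b fun j => by
        simpa [v, WithLp.prod_inner_apply] using hx (.inr j)
  exact ⟨c, fun i => by rw [hc]; rfl, fun j => by rw [hc]; rfl⟩

end Models

section Wold

variable {H : Type*} [NormedAddCommGroup H] [InnerProductSpace ℂ H]

/-- The intersection of the ranges of the powers of an isometry: the space of the unitary summand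
in its Wold decomposition. -/
noncomputable def unitaryPart (U : H →ₗᵢ[ℂ] H) : Submodule ℂ H :=
  ⨅ n : ℕ, LinearMap.range (U ^ n).toLinearMap

variable {U : H →ₗᵢ[ℂ] H}

lemma mem_unitaryPart {f : H} : f ∈ unitaryPart U ↔ ∀ n : ℕ, ∃ g, (U ^ n) g = f := by
  simp only [unitaryPart, Submodule.mem_iInf]
  rfl

lemma map_mem_unitaryPart_iff {f : H} : U f ∈ unitaryPart U ↔ f ∈ unitaryPart U := by
  simp only [mem_unitaryPart]
  refine ⟨fun h n => ?_, fun h n => ?_⟩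
  · obtain ⟨g, hg⟩ := h (n + 1)
    exact ⟨g, U.injective (by rw [← hg, pow_succ']; rfl)⟩
  · cases n with
    | zero => exact ⟨U f, rfl⟩
    | succ n =>
      obtain ⟨g, rfl⟩ := h n
      exact ⟨g, by rw [pow_succ']; rfl⟩

lemma exists_map_eq_of_mem_unitaryPart {f : H} (hf : f ∈ unitaryPart U) :
    ∃ g ∈ unitaryPart U, U g = f := by
  obtain ⟨g, rfl⟩ := mem_unitaryPart.1 hf 1
  exact ⟨g, map_mem_unitaryPart_iff.1 hf, rfl⟩

section
variable {z : H} (hz : z ∈ (LinearMap.range U.toLinearMap)ᗮ)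
include hz

lemma inner_map_right_of_mem_orthogonal (f : H) : inner ℂ z (U f) = 0 :=
  (Submodule.mem_orthogonal' _ z).1 hz _ (LinearMap.mem_range_self U.toLinearMap f)

lemma inner_pow_map_of_mem_unitaryPart {f : H} (hf : f ∈ unitaryPart U) (k : ℕ) :
    inner ℂ ((U ^ k) z) f = 0 := by
  obtain ⟨g, rfl⟩ := mem_unitaryPart.1 hf (k + 1)
  rw [pow_succ]
  change inner ℂ ((U ^ k) z) ((U ^ k) (U g)) = 0
  rw [LinearIsometry.inner_map_map, inner_map_right_of_mem_orthogonal hz]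

lemma inner_pow_map_pow_of_lt {w : H} {k l : ℕ} (h : k < l) :
    inner ℂ ((U ^ k) z) ((U ^ l) w) = 0 := by
  obtain ⟨m, rfl⟩ := Nat.exists_eq_add_of_lt h
  rw [add_assoc, pow_add, pow_succ']
  change inner ℂ ((U ^ k) z) ((U ^ k) (U ((U ^ m) w))) = 0
  rw [LinearIsometry.inner_map_map, inner_map_right_of_mem_orthogonal hz]

end

section Basis

variable {N : Type*} (z : HilbertBasis N ℂ ↥(LinearMap.range U.toLinearMap)ᗮ)

lemma orthonormal_pow_wandering : Orthonormal ℂ fun p : N × ℕ => (U ^ p.2) (z p.1 : H) := by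
  refine ⟨fun p => ?_, ?_⟩
  · rw [LinearIsometry.norm_map]
    exact z.orthonormal.1 p.1
  rintro ⟨i, k⟩ ⟨j, l⟩ h
  change inner ℂ ((U ^ k) (z i : H)) ((U ^ l) (z j)) = 0
  rcases lt_trichotomy k l with hkl | rfl | hlk
  · exact inner_pow_map_pow_of_lt (z i).2 hkl
  · rw [LinearIsometry.inner_map_map]
    exact z.orthonormal.2 fun hij => h (Prod.ext hij rfl)
  · exact inner_eq_zero_symm.1 (inner_pow_map_pow_of_lt (z j).2 hlk)

variable [CompleteSpace H]

lemma mem_range_of_forall_inner_wandering {f : H} (hf : ∀ i, inner ℂ (z i : H) f = 0) :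
    ∃ g, U g = f := by
  have hclosed : IsClosed (LinearMap.range U.toLinearMap : Set H) := by
    rw [LinearMap.coe_range]
    exact U.isometry.isClosedEmbedding.isClosed_range
  have : CompleteSpace (LinearMap.range U.toLinearMap) := hclosed.completeSpace_coe
  have hproj : (LinearMap.range U.toLinearMap)ᗮ.orthogonalProjectionOnto f = 0 :=
    eq_zero_of_inner_hilbertBasis z fun i => by
      rw [Submodule.inner_orthogonalProjectionOnto_eq_of_mem_left, hf]
  have hmem := Submodule.orthogonalProjectionOnto_eq_zero_iff.1 hproj
  rwa [Submodule.orthogonal_orthogonal] at hmem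

lemma mem_unitaryPart_iff_forall_inner_pow {f : H} :
    f ∈ unitaryPart U ↔ ∀ i k, inner ℂ ((U ^ k) (z i : H)) f = 0 := by
  refine ⟨fun hf i k => inner_pow_map_of_mem_unitaryPart (z i).2 hf k, fun hf => ?_⟩
  refine mem_unitaryPart.2 fun n => ?_
  induction n with
  | zero => exact ⟨f, rfl⟩
  | succ n ih =>
    obtain ⟨g, rfl⟩ := ih
    obtain ⟨g, rfl⟩ := mem_range_of_forall_inner_wandering z fun i => by
      rw [← (U ^ n).inner_map_map, hf]
    exact ⟨g, by rw [pow_succ]; rfl⟩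

theorem exists_hilbertBasis_wold {M : Type*} (x : HilbertBasis M ℂ (unitaryPart U)) :
    ∃ b : HilbertBasis (M ⊕ N × ℕ) ℂ H,
      (∀ m, b (.inl m) = x m) ∧ ∀ i k, b (.inr (i, k)) = (U ^ k) (z i : H) := by
  let v : M ⊕ N × ℕ → H := Sum.elim (fun m => x m) (fun p => (U ^ p.2) (z p.1 : H))
  have hv : Orthonormal ℂ v := by
    refine ⟨?_, ?_⟩
    · rintro (m | p)
      exacts [x.orthonormal.1 m, (orthonormal_pow_wandering z).1 p]
    · rintro (m | p) (m' | p') h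
      · exact x.orthonormal.2 fun hm => h (congrArg _ hm)
      · exact inner_eq_zero_symm.1 (inner_pow_map_of_mem_unitaryPart (z p'.1).2 (x m).2 p'.2)
      · exact inner_pow_map_of_mem_unitaryPart (z p.1).2 (x m').2 p.2
      · exact (orthonormal_pow_wandering z).2 fun hp => h (congrArg _ hp)
  obtain ⟨b, hb⟩ := exists_hilbertBasis_of_total hv fun f hf => by
    have hfP : f ∈ unitaryPart U := (mem_unitaryPart_iff_forall_inner_pow z).2 fun i k =>
      hf (.inr (i, k))
    exact congrArg Subtype.val (eq_zero_of_inner_hilbertBasis x (x := ⟨f, hfP⟩) fun m =>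
      hf (.inl m))
  exact ⟨b, fun m => by rw [hb]; rfl, fun i k => by rw [hb]; rfl⟩

end Basis

variable [CompleteSpace H]

lemma adjoint_map_eq_self (f : H) : ContinuousLinearMap.adjoint U.toContinuousLinearMap (U f) = f :=
  DFunLike.congr_fun
    ((ContinuousLinearMap.norm_map_iff_adjoint_comp_self U.toContinuousLinearMap).1 U.norm_map) f

lemma isClosed_unitaryPart : IsClosed (unitaryPart U : Set H) := by
  rw [unitaryPart, Submodule.coe_iInf]
  refine isClosed_iInter fun n => ?_
  rw [LinearMap.coe_range]
  exact (U ^ n).isometry.isClosedEmbedding.isClosed_range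

theorem isCNU_iff_unitaryPart_eq_bot : IsCNU U.toContinuousLinearMap ↔ unitaryPart U = ⊥ := by
  constructor
  · refine fun h => h _ isClosed_unitaryPart (fun f hf => map_mem_unitaryPart_iff.2 hf)
      (fun f hf => ?_) (fun f _ => U.norm_map f) fun f hf => exists_map_eq_of_mem_unitaryPart hf
    obtain ⟨g, hg, rfl⟩ := exists_map_eq_of_mem_unitaryPart hf
    rwa [adjoint_map_eq_self]
  · refine fun h M _ _ _ _ hsurj => eq_bot_iff.2 fun f hf => ?_
    have hpow (n : ℕ) : ∀ f ∈ M, ∃ g ∈ M, (U ^ n) g = f := by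
      induction n with
      | zero => exact fun f hf => ⟨f, hf, rfl⟩
      | succ n ih =>
        intro f hf
        obtain ⟨g, hg, rfl⟩ := ih f hf
        obtain ⟨g', hg', rfl⟩ := hsurj g hg
        exact ⟨g', hg', by rw [pow_succ]; rfl⟩
    exact h ▸ mem_unitaryPart.2 fun n => (hpow n f hf).imp fun _ => And.right

variable {n : ℕ∞} (z : HilbertBasis (IndexSet n) ℂ ↥(LinearMap.range U.toLinearMap)ᗮ)
include z

theorem unitarilyEquivalent_unilateralShiftMult (hU : unitaryPart U = ⊥) :
    UnitarilyEquivalent U.toContinuousLinearMap (unilateralShiftMult n) := by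
  obtain ⟨b, hb⟩ := exists_hilbertBasis_of_total (orthonormal_pow_wandering z) fun f hf =>
    (Submodule.eq_bot_iff _).1 hU f
      ((mem_unitaryPart_iff_forall_inner_pow z).2 fun i k => hf (i, k))
  obtain ⟨b', hb'⟩ := exists_hilbertBasis_unilateralShiftMult n
  refine .of_hilbertBasis b b' (Prod.map id Nat.succ) ?_ fun p => hb' p.1 p.2
  rintro ⟨i, k⟩
  simp only [hb, Prod.map_apply, id_eq, Nat.succ_eq_add_one, pow_succ']
  rfl

theorem unitarilyEquivalent_orthSum_bilateralShift (x : HilbertBasis ℤ ℂ (unitaryPart U))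
    (hx : ∀ m, U (x m) = x (m + 1)) :
    UnitarilyEquivalent U.toContinuousLinearMap
      (orthSum bilateralShift.toContinuousLinearMap (unilateralShiftMult n)) := by
  obtain ⟨b, hbx, hbz⟩ := exists_hilbertBasis_wold z x
  obtain ⟨a, ha⟩ := exists_hilbertBasis_basisVec ℤ
  obtain ⟨b', hb'⟩ := exists_hilbertBasis_unilateralShiftMult n
  obtain ⟨c, hca, hcb⟩ := exists_hilbertBasis_withLp_prod a b'
  refine .of_hilbertBasis b c (Sum.map (· + 1) (Prod.map id Nat.succ)) ?_ ?_
  · rintro (m | ⟨i, k⟩)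
    · simp only [Sum.map_inl, hbx, ← hx]
      rfl
    · simp only [Sum.map_inr, Prod.map_apply, id_eq, Nat.succ_eq_add_one, hbz, pow_succ']
      rfl
  · rintro (m | ⟨i, k⟩)
    · simp only [Sum.map_inl, hca, ha]
      rw [← ell2Map_basisVec (add_left_injective (1 : ℤ)) m]
      exact WithLp.ofLp_injective 2 (Prod.ext rfl (map_zero (unilateralShiftMult n)))
    · simp only [Sum.map_inr, Prod.map_apply, id_eq, Nat.succ_eq_add_one, hcb, ← hb']
      exact WithLp.ofLp_injective 2 (Prod.ext (map_zero bilateralShift) rfl)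

end Wold

section Encard

lemma encard_le_of_forall_finset {α : Type*} {s : Set α} {c : ℕ∞}
    (h : ∀ t : Finset α, ↑t ⊆ s → (t.card : ℕ∞) ≤ c) : s.encard ≤ c := by
  rcases s.finite_or_infinite with hs | hs
  · rw [hs.encard_eq_coe_toFinset_card]
    exact h _ hs.coe_toFinset.subset
  · refine le_top.trans_eq (Eq.symm (ENat.eq_top_iff_forall_ge.2 fun n => ?_))
    obtain ⟨t, ht, rfl⟩ := hs.exists_subset_card_eq n
    exact h t ht

lemma encard_iUnion_eq_iSup_sum {α ι : Type*} {F : ι → Set α}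
    (hF : Pairwise (Function.onFun Disjoint F)) :
    (⋃ i, F i).encard = ⨆ s : Finset ι, ∑ i ∈ s, (F i).encard := by
  have hfin (s : Finset ι) : (⋃ i ∈ s, F i).encard = ∑ i ∈ s, (F i).encard :=
    (s.finite_toSet.encard_biUnion (hF.set_pairwise _)).trans (finsum_mem_coe_finset _ s)
  simp only [← hfin]
  refine le_antisymm (encard_le_of_forall_finset fun t ht => ?_) (iSup_le fun s =>
    Set.encard_le_encard (Set.iUnion₂_subset fun i _ => Set.subset_iUnion F i))
  obtain ⟨I, hI, htI⟩ := Set.finite_subset_iUnion t.finite_toSet ht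
  rw [← Set.encard_coe_eq_coe_finsetCard]
  refine (Set.encard_le_encard htI).trans ?_
  simpa only [hI.mem_toFinset] using
    le_iSup (fun s : Finset ι => (⋃ i ∈ s, F i).encard) hI.toFinset

lemma exists_equiv_indexSet {α : Type*} [Countable α] {n : ℕ∞} (h : ENat.card α = n) :
    Nonempty (α ≃ IndexSet n) := by
  cases n with
  | top =>
    have : Infinite α := ENat.card_eq_top.1 h
    obtain ⟨e⟩ : Nonempty (α ≃ ℕ) := nonempty_equiv_of_countable
    exact ⟨e.trans (Equiv.subtypeUnivEquiv ENat.natCast_lt_top).symm⟩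
  | coe k =>
    have : Finite α := by
      rw [← not_infinite_iff_finite, ← ENat.card_eq_top, h]
      exact ENat.natCast_ne_top k
    have hk : Nat.card α = k := by
      rw [ENat.card_eq_coe_natCard] at h
      exact_mod_cast h
    exact ⟨(Finite.equivFinOfCardEq hk).trans
      (Fin.equivSubtype.trans (Equiv.subtypeEquivRight fun i => Nat.cast_lt.symm))⟩

end Encard

section Counting

variable {V : Type*} {G : Digraph V} (hG : IsDirectedTree G)
include hG

open Classical in
lemma IsDirectedTree.encard_setOf_isRoot :
    {v | IsRoot G v}.encard = if HasRoot G then 1 else 0 := by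
  split_ifs with h
  · obtain ⟨r, hr⟩ := h
    exact Set.encard_eq_one.2
      ⟨r, Set.eq_singleton_iff_unique_mem.2 ⟨hr, fun v hv => hG.isRoot_unique hv hr⟩⟩
  · rw [Set.encard_eq_zero, Set.eq_empty_iff_forall_notMem]
    exact fun v hv => h ⟨v, hv⟩

variable {s : V → V} (hs : ∀ u, G.Adj u (s u))
include hs

lemma IsDirectedTree.injective_of_adj : Function.Injective s := fun u v h =>
  hG.parent_unique _ _ _ (hs u) (h ▸ hs v)

lemma IsDirectedTree.compl_range_eq :
    (Set.range s)ᶜ =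
      (⋃ u : {u : V // 1 < (chi G u).encard}, chi G u \ {s u}) ∪ {v | IsRoot G v} := by
  ext v
  simp only [Set.mem_compl_iff, Set.mem_range, not_exists, Set.mem_union, Set.mem_iUnion]
  constructor
  · intro hv
    by_cases hr : IsRoot G v
    · exact .inr hr
    · have hp : v ∈ chi G (par G v) := adj_par_of_not_isRoot hr
      have hne : v ≠ s (par G v) := fun h => hv _ h.symm
      exact .inl ⟨⟨par G v, Set.one_lt_encard_iff.2 ⟨v, s (par G v), hp, hs _, hne⟩⟩, hp, hne⟩
  · rintro (⟨u, hu, hne⟩ | hr) w rfl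
    · exact hne (congrArg s (hG.parent_unique _ _ _ (hs w) hu))
    · exact hr w (hs w)

open Classical in
/-- Each vertex other than the root is a child of exactly one vertex, so that after removing one
child of every vertex there remain `|chi u| - 1` children of each branching vertex `u`, and the
root. -/
lemma IsDirectedTree.card_compl_range :
    ENat.card ↥(Set.range s)ᶜ = branchingIndex G + if HasRoot G then 1 else 0 := by
  have hdisj : Disjoint (⋃ u : {u : V // 1 < (chi G u).encard}, chi G u \ {s u})
      {v | IsRoot G v} := by
    refine Set.disjoint_left.2 fun v hv hr => ?_
    obtain ⟨u, hu, -⟩ := Set.mem_iUnion.1 hv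
    exact hr u hu
  have hpair : Pairwise (Function.onFun Disjoint
      fun u : {u : V // 1 < (chi G u).encard} => chi G u \ {s u}) := fun u w huw =>
    Set.disjoint_left.2 fun v hu hw => huw (Subtype.ext (hG.parent_unique _ _ _ hu.1 hw.1))
  rw [ENat.card_coe_set_eq, hG.compl_range_eq hs, Set.encard_union_eq hdisj,
    hG.encard_setOf_isRoot, encard_iUnion_eq_iSup_sum hpair, branchingIndex]
  congr 2 with t
  exact Finset.sum_congr rfl fun u _ => Set.encard_sdiff_singleton_of_mem (hs u)

end Counting

section HilbertSpace

variable {𝕜 E ι : Type*} [RCLike 𝕜] [NormedAddCommGroup E] [InnerProductSpace 𝕜 E]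

lemma exists_linearIsometryEquiv_map_eq [CompleteSpace E] {a b : ι → E}
    (haa : ∀ i j, inner 𝕜 (a i) (a j) = inner 𝕜 (b i) (b j))
    (hab : ∀ i j, inner 𝕜 (a i) (b j) = inner 𝕜 (b i) (a j)) :
    ∃ R : E ≃ₗᵢ[𝕜] E, ∀ i, R (a i) = b i := by
  -- The reflection that negates every `a i - b i` fixes every `a i + b i`.
  set K := Submodule.span 𝕜 (Set.range fun i => a i - b i)
  refine ⟨Kᗮ.reflection, fun i => ?_⟩
  have hsub : Kᗮ.reflection (a i - b i) = -(a i - b i) :=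
    Submodule.reflection_mem_subspace_orthogonalComplement_eq_neg
      (K.le_orthogonal_orthogonal (Submodule.subset_span (Set.mem_range_self i)))
  have hadd : Kᗮ.reflection (a i + b i) = a i + b i := by
    refine Submodule.reflection_mem_subspace_eq_self (mem_orthogonal_span_iff.2 ?_)
    rintro _ ⟨j, rfl⟩
    rw [inner_sub_left, inner_add_right, inner_add_right, haa, hab]
    ring
  refine smul_right_injective E (two_ne_zero (α := 𝕜)) ?_
  change (2 : 𝕜) • Kᗮ.reflection (a i) = (2 : 𝕜) • b i
  calc (2 : 𝕜) • Kᗮ.reflection (a i)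
      = Kᗮ.reflection (a i + b i) + Kᗮ.reflection (a i - b i) := by
        rw [← map_smul, ← map_add, two_smul]
        congr 1
        abel
    _ = (2 : 𝕜) • b i := by
        rw [hsub, hadd, two_smul]
        abel

lemma exists_hilbertBasis_reindex [CompleteSpace E] {κ : Type*} (b : HilbertBasis ι 𝕜 E)
    (e : κ ≃ ι) : ∃ b' : HilbertBasis κ 𝕜 E, ⇑b' = b ∘ e :=
  exists_hilbertBasis_of_total (b.orthonormal.comp e e.injective) fun _ hx =>
    eq_zero_of_inner_hilbertBasis b fun i => by simpa using hx (e.symm i)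

lemma nonempty_hilbertBasis_orthogonal_range [CompleteSpace E] {F κ : Type*}
    [NormedAddCommGroup F] [InnerProductSpace 𝕜 F] [CompleteSpace F] {U : F →ₗᵢ[𝕜] E}
    (b : HilbertBasis ι 𝕜 E) (e : HilbertBasis κ 𝕜 F) {s : κ → ι} (h : ∀ k, b (s k) = U (e k)) :
    Nonempty (HilbertBasis ↥(Set.range s)ᶜ 𝕜 (LinearMap.range U.toLinearMap)ᗮ) := by
  have hmem (i : ↥(Set.range s)ᶜ) : b i ∈ (LinearMap.range U.toLinearMap)ᗮ := by
    have hadj : ContinuousLinearMap.adjoint U.toContinuousLinearMap (b i) = 0 := by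
      refine eq_zero_of_inner_hilbertBasis e fun k => ?_
      rw [ContinuousLinearMap.adjoint_inner_right]
      change inner 𝕜 (U (e k)) (b i) = 0
      rw [← h]
      exact b.orthonormal.2 fun hk => i.2 ⟨k, hk⟩
    rintro _ ⟨f, rfl⟩
    change inner 𝕜 (U.toContinuousLinearMap f) (b i) = 0
    rw [← ContinuousLinearMap.adjoint_inner_right, hadj, inner_zero_right]
  obtain ⟨z, -⟩ := exists_hilbertBasis_of_total
    (b.orthonormal.comp _ Subtype.val_injective |>.codRestrict _ hmem) fun x hx =>
      Subtype.ext <| eq_zero_of_inner_hilbertBasis b fun i => by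
        by_cases hi : i ∈ Set.range s
        · obtain ⟨k, rfl⟩ := hi
          rw [h]
          exact x.2 _ ⟨e k, rfl⟩
        · exact hx ⟨i, hi⟩
  exact ⟨z⟩

end HilbertSpace

section IsometricShift

variable {V : Type*} {G : Digraph V} {lam : V → ℝ} {hb : BoundedWeights G lam}
  {U : Ell2 V →ₗᵢ[ℂ] Ell2 V} (hG : IsDirectedTree G)
  (hU : U.toContinuousLinearMap = weightedShift G lam hb)
include hU

lemma isometricShift_apply (f : Ell2 V) (v : V) :
    U f v = (effWeight G lam v : ℂ) * f (par G v) := by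
  rw [← weightedShift_coord (hb := hb), ← hU]
  rfl

include hG

lemma isometricShift_basisVec_apply (u v : V) :
    U (basisVec u) v = ((chi G u).indicator lam v : ℝ) := by
  rw [← weightedShift_basisVec_apply hG (hb := hb), ← hU]
  rfl

lemma hasSum_chi_sq_of_isometricShift (u : V) :
    HasSum (fun v : chi G u => |lam v| ^ 2) 1 := by
  have h := hasSum_norm_sq (U (basisVec u))
  rw [U.norm_map, norm_basisVec, one_pow] at h
  refine (hasSum_subtype_iff_indicator (f := fun v => |lam v| ^ 2)).2 (h.congr_fun fun v => ?_)
  rw [isometricShift_basisVec_apply hG hU, Complex.norm_real, Real.norm_eq_abs]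
  by_cases hv : v ∈ chi G u <;> simp [hv]

lemma countable_of_isometricShift (hne : ∀ u v, G.Adj u v → lam v ≠ 0) : Countable V := by
  refine hG.countable fun u => ?_
  have h := (hasSum_chi_sq_of_isometricShift hG hU u).summable.countable_support
  rw [Function.support_eq_univ fun v : chi G u =>
    pow_ne_zero 2 (abs_ne_zero.2 (hne u v v.2))] at h
  exact Set.countable_coe_iff.1 (Set.countable_univ_iff.1 h)

lemma exists_linearIsometryEquiv_map_basisVec {s : V → V} (hs : ∀ u, G.Adj u (s u)) :
    ∃ R : Ell2 V ≃ₗᵢ[ℂ] Ell2 V, ∀ u, R (basisVec (s u)) = U (basisVec u) := by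
  classical
  have hcoord (u w : V) : U (basisVec w) (s u) = ((if u = w then lam (s u) else 0 : ℝ) : ℂ) := by
    have hiff : s u ∈ chi G w ↔ u = w := ⟨hG.parent_unique _ _ _ (hs u), fun h => h ▸ hs u⟩
    rw [isometricShift_basisVec_apply hG hU, Set.indicator_apply]
    simp only [hiff]
  refine exists_linearIsometryEquiv_map_eq (fun u w => ?_) (fun u w => ?_)
  · simp only [U.inner_map_map, inner_basisVec_left, basisVec_apply,
      (hG.injective_of_adj hs).eq_iff]
  · rw [← inner_conj_symm (U _), inner_basisVec_left, inner_basisVec_left, hcoord, hcoord,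
      Complex.conj_ofReal]
    rcases eq_or_ne u w with rfl | h
    · rfl
    · rw [if_neg h, if_neg h.symm]

open Classical in
lemma nonempty_hilbertBasis_wandering (hne : ∀ u v, G.Adj u v → lam v ≠ 0) :
    Nonempty (HilbertBasis (IndexSet (branchingIndex G + if HasRoot G then 1 else 0)) ℂ
      (LinearMap.range U.toLinearMap)ᗮ) := by
  have := countable_of_isometricShift hG hU hne
  choose s hs using isLeafless_of_hasSum_one (hasSum_chi_sq_of_isometricShift hG hU)
  obtain ⟨R, hR⟩ := exists_linearIsometryEquiv_map_basisVec hG hU hs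
  obtain ⟨e, he⟩ := exists_hilbertBasis_basisVec V
  obtain ⟨z⟩ := nonempty_hilbertBasis_orthogonal_range (U := U) (s := s)
    (HilbertBasis.ofRepr (R.symm.trans e.repr)) e fun u => by
      classical
      rw [he, ← hR, ← he, ← HilbertBasis.repr_symm_single, ← e.repr_symm_single]
      rfl
  obtain ⟨σ⟩ := exists_equiv_indexSet (hG.card_compl_range hs)
  exact ⟨(exists_hilbertBasis_reindex z σ.symm).choose⟩

end IsometricShift

section PathProducts

lemma multipliable_of_mem_unitInterval {ι : Type*} {a : ι → ℝ} (h0 : ∀ i, 0 ≤ a i)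
    (h1 : ∀ i, a i ≤ 1) : Multipliable a := by
  classical
  refine ⟨⨅ s : Finset ι, ∏ i ∈ s, a i, tendsto_atTop_ciInf (fun s t hst => ?_) ⟨0, ?_⟩⟩
  · rw [← Finset.prod_sdiff hst]
    exact mul_le_of_le_one_left (Finset.prod_nonneg fun i _ => h0 i)
      (Finset.prod_le_one (fun i _ => h0 i) fun i _ => h1 i)
  · rintro _ ⟨s, rfl⟩
    exact Finset.prod_nonneg fun i _ => h0 i

variable {V : Type*} {G : Digraph V} {lam : V → ℝ}

/-- The product of the squared weights along the infinite path from `v` upwards. In a tree with a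
root the path is eventually constant, so the notion is only meaningful without a root. -/
noncomputable def pathProd (G : Digraph V) (lam : V → ℝ) (v : V) : ℝ :=
  ∏' j : ℕ, lam ((par G)^[j] v) ^ 2

variable (hle : ∀ v, lam v ^ 2 ≤ 1)
include hle

lemma tendsto_pathProd (v : V) :
    Tendsto (fun n => ∏ j ∈ Finset.range n, lam ((par G)^[j] v) ^ 2) atTop
      (𝓝 (pathProd G lam v)) :=
  (multipliable_of_mem_unitInterval (fun _ => sq_nonneg _) fun _ => hle _).hasProd.tendsto_prod_nat

lemma pathProd_nonneg (v : V) : 0 ≤ pathProd G lam v :=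
  ge_of_tendsto' (tendsto_pathProd hle v) fun _ => Finset.prod_nonneg fun _ _ => sq_nonneg _

lemma pathProd_le_one (v : V) : pathProd G lam v ≤ 1 :=
  le_of_tendsto' (tendsto_pathProd hle v) fun _ =>
    Finset.prod_le_one (fun _ _ => sq_nonneg _) fun _ _ => hle _

lemma pathProd_eq_mul (v : V) : pathProd G lam v = lam v ^ 2 * pathProd G lam (par G v) := by
  refine tendsto_nhds_unique ((tendsto_pathProd hle v).comp (tendsto_add_atTop_nat 1))
    (((tendsto_pathProd hle (par G v)).const_mul (lam v ^ 2)).congr fun n => ?_)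
  rw [Function.comp_apply, Finset.prod_range_succ', mul_comm]
  rfl

lemma pathProd_eq_prod_mul (n : ℕ) (v : V) : pathProd G lam v =
    (∏ j ∈ Finset.range n, lam ((par G)^[j] v)) ^ 2 * pathProd G lam ((par G)^[n] v) := by
  induction n with
  | zero => simp
  | succ n ih =>
    rw [ih, Finset.prod_range_succ, pathProd_eq_mul hle ((par G)^[n] v),
      Function.iterate_succ_apply', mul_pow, mul_assoc]

lemma sqrt_pathProd_eq_prod_mul (hnonneg : ∀ v, 0 ≤ lam v) (n : ℕ) (v : V) :
    √(pathProd G lam v) =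
      (∏ j ∈ Finset.range n, lam ((par G)^[j] v)) * √(pathProd G lam ((par G)^[n] v)) := by
  rw [pathProd_eq_prod_mul hle n v, Real.sqrt_mul (sq_nonneg _),
    Real.sqrt_sq (Finset.prod_nonneg fun _ _ => hnonneg _)]

lemma hasSum_gen_pathProd_zero_iff (hG : IsDirectedTree G) (hne : ∀ v, lam v ≠ 0) (u : V) :
    HasSum (fun v : gen G u => pathProd G lam v) 0 ↔ ∀ v, pathProd G lam v = 0 := by
  rw [hasSum_zero_iff_of_nonneg fun v : gen G u => pathProd_nonneg hle (v : V)]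
  refine ⟨fun h => hG.forall_of_iff_par (u := u) (fun v => ?_) ?_, fun h => funext fun v => h v⟩
  · rw [pathProd_eq_mul hle v, mul_eq_zero_iff_left (pow_ne_zero 2 (hne v))]
  · exact congrFun h ⟨u, 0, u, rfl, rfl⟩

end PathProducts

section UnitaryPart

variable {V : Type*} {G : Digraph V} {lam : V → ℝ} {hb : BoundedWeights G lam}
  {U : Ell2 V →ₗᵢ[ℂ] Ell2 V} (hG : IsDirectedTree G)
  (hU : U.toContinuousLinearMap = weightedShift G lam hb)
include hU

lemma isometricShift_pow_apply (n : ℕ) (f : Ell2 V) (v : V) :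
    (U ^ n) f v = ((∏ j ∈ Finset.range n, effWeight G lam ((par G)^[j] v) : ℝ) : ℂ) *
      f ((par G)^[n] v) := by
  have hpow : (U ^ n) f = (U.toContinuousLinearMap ^ n) f := by
    induction n with
    | zero => rfl
    | succ n ih =>
      rw [pow_succ', pow_succ']
      exact congrArg U ih
  rw [hpow, hU, weightedShift_pow_coord]

include hG

lemma unitaryPart_eq_bot_of_hasRoot (hr : HasRoot G) : unitaryPart U = ⊥ := by
  obtain ⟨r, hr⟩ := hr
  refine (Submodule.eq_bot_iff _).2 fun f hf => lp.ext (funext fun v => ?_)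
  obtain ⟨n, hn⟩ := hG.exists_iterate_par_eq_root hr v
  obtain ⟨g, rfl⟩ := mem_unitaryPart.1 hf (n + 1)
  rw [isometricShift_pow_apply hU, Finset.prod_range_succ, hn, effWeight_of_isRoot hr]
  simp

section Rootless
variable (hr : ¬ HasRoot G)
include hr

omit hG hU in
lemma effWeight_of_not_hasRoot : effWeight G lam = lam :=
  funext fun v => effWeight_of_not_isRoot (not_isRoot_of_not_hasRoot hr v)

lemma sq_weight_le_one (v : V) : lam v ^ 2 ≤ 1 := by
  have hv : v ∈ chi G (par G v) := adj_par_of_not_isRoot (not_isRoot_of_not_hasRoot hr v)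
  rw [← sq_abs]
  exact le_hasSum (hasSum_chi_sq_of_isometricShift hG hU (par G v)) ⟨v, hv⟩
    fun _ _ => sq_nonneg _

lemma norm_sq_apply_le_of_mem_unitaryPart {f : Ell2 V} (hf : f ∈ unitaryPart U) (v : V) :
    ‖f v‖ ^ 2 ≤ pathProd G lam v * ‖f‖ ^ 2 := by
  refine ge_of_tendsto' ((tendsto_pathProd (sq_weight_le_one hG hU hr) v).mul_const _) fun n => ?_
  obtain ⟨g, rfl⟩ := mem_unitaryPart.1 hf n
  rw [isometricShift_pow_apply hU, effWeight_of_not_hasRoot hr, norm_mul, mul_pow,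
    Complex.norm_real, Real.norm_eq_abs, sq_abs, Finset.prod_pow, LinearIsometry.norm_map]
  gcongr
  exact lp.norm_apply_le_norm two_ne_zero g _

end Rootless

variable {ht : V → ℤ} (hht : ∀ v, ht v = ht (par G v) + 1)
include hht

omit hU in
lemma eventually_iterate_par_eq {u v : V} (h : ht v = ht u) :
    ∀ᶠ n in atTop, (par G)^[n] v = (par G)^[n] u := by
  obtain ⟨n, hn⟩ := hG.exists_iterate_par_eq_of_height_eq hht h
  refine eventually_atTop.2 ⟨n, fun k hk => ?_⟩
  obtain ⟨d, rfl⟩ := Nat.exists_eq_add_of_le' hk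
  rw [Function.iterate_add_apply, hn, ← Function.iterate_add_apply]

lemma sum_pathProd_le_one {u : V} {t : Finset V} (htu : ∀ v ∈ t, ht v = ht u) :
    ∑ v ∈ t, pathProd G lam v ≤ 1 := by
  have hr := not_hasRoot_of_height hht
  have hle := sq_weight_le_one hG hU hr
  obtain ⟨n, hn⟩ := ((eventually_all_finset t).2 fun v hv =>
    eventually_iterate_par_eq hG hht (htu v hv)).exists
  have hsum := hasSum_norm_sq ((U ^ n) (basisVec ((par G)^[n] u)))
  rw [LinearIsometry.norm_map, norm_basisVec, one_pow] at hsum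
  refine (Finset.sum_le_sum fun v hv => ?_).trans (sum_le_hasSum t (fun _ _ => sq_nonneg _) hsum)
  rw [isometricShift_pow_apply hU, effWeight_of_not_hasRoot hr, basisVec_apply, if_pos (hn v hv),
    mul_one, Complex.norm_real, Real.norm_eq_abs, sq_abs, pathProd_eq_prod_mul hle n v]
  exact mul_le_of_le_one_right (sq_nonneg _) (pathProd_le_one hle _)

lemma memℓp_sqrt_pathProd_level (m : ℤ) :
    Memℓp (fun v => ((if ht v = m then √(pathProd G lam v) else 0 : ℝ) : ℂ)) 2 := by
  have hle := sq_weight_le_one hG hU (not_hasRoot_of_height hht)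
  refine memℓp_gen' (C := 1) fun t => ?_
  have hterm (v : V) : ‖((if ht v = m then √(pathProd G lam v) else 0 : ℝ) : ℂ)‖ ^
      (2 : ℝ≥0∞).toReal = if ht v = m then pathProd G lam v else 0 := by
    split_ifs <;> simp [Real.sq_sqrt, pathProd_nonneg hle]
  simp only [hterm, ← Finset.sum_filter]
  rcases (t.filter (ht · = m)).eq_empty_or_nonempty with h | ⟨u, hu⟩
  · simp [h]
  · refine sum_pathProd_le_one hG hU hht (u := u) fun v hv => ?_
    rw [(Finset.mem_filter.1 hv).2, (Finset.mem_filter.1 hu).2]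

omit hG hU hht in
/-- The vector `∑ √(pathProd v) e_v`, the sum being over the vertices `v` of height `m`. These
vectors span the unitary part of `U`. -/
noncomputable def levelVec (hG : IsDirectedTree G)
    (hU : U.toContinuousLinearMap = weightedShift G lam hb)
    (hht : ∀ v, ht v = ht (par G v) + 1) (m : ℤ) : Ell2 V :=
  ⟨_, memℓp_sqrt_pathProd_level hG hU hht m⟩

lemma levelVec_apply (m : ℤ) (v : V) :
    levelVec hG hU hht m v = ((if ht v = m then √(pathProd G lam v) else 0 : ℝ) : ℂ) := rfl

lemma sqrt_pathProd_mul_apply_comm (hnonneg : ∀ v, 0 ≤ lam v) {f : Ell2 V}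
    (hf : f ∈ unitaryPart U) {v w : V} (h : ht v = ht w) :
    (√(pathProd G lam w) : ℂ) * f v = (√(pathProd G lam v) : ℂ) * f w := by
  have hr := not_hasRoot_of_height hht
  have hsqrt := sqrt_pathProd_eq_prod_mul (G := G) (sq_weight_le_one hG hU hr) hnonneg
  obtain ⟨n, hn⟩ := hG.exists_iterate_par_eq_of_height_eq hht h
  obtain ⟨g, rfl⟩ := mem_unitaryPart.1 hf n
  rw [isometricShift_pow_apply hU, isometricShift_pow_apply hU, effWeight_of_not_hasRoot hr,
    hsqrt n v, hsqrt n w, hn]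
  push_cast
  ring

lemma pathProd_eq_zero_of_levelVec_eq_zero {v : V} (h : levelVec hG hU hht (ht v) = 0) :
    pathProd G lam v = 0 := by
  have hyv := levelVec_apply hG hU hht (ht v) v
  rwa [if_pos rfl, h, eq_comm, lp.coeFn_zero, Pi.zero_apply, Complex.ofReal_eq_zero,
    Real.sqrt_eq_zero (pathProd_nonneg (sq_weight_le_one hG hU (not_hasRoot_of_height hht)) v)]
    at hyv

lemma inner_levelVec_of_ne {m k : ℤ} (hmk : m ≠ k) :
    inner ℂ (levelVec hG hU hht m) (levelVec hG hU hht k) = 0 := by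
  refine (lp.hasSum_inner (𝕜 := ℂ) (levelVec hG hU hht m) (levelVec hG hU hht k)).unique
    (hasSum_zero.congr_fun fun v => ?_)
  rw [levelVec_apply, levelVec_apply]
  rcases eq_or_ne (ht v) m with h | h
  · simp [h, hmk]
  · simp [h]

variable (hnonneg : ∀ v, 0 ≤ lam v)
include hnonneg

lemma map_levelVec (m : ℤ) : U (levelVec hG hU hht m) = levelVec hG hU hht (m + 1) := by
  have hr := not_hasRoot_of_height hht
  refine lp.ext (funext fun v => ?_)
  rw [isometricShift_apply hU, effWeight_of_not_hasRoot hr, levelVec_apply, levelVec_apply,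
    pathProd_eq_mul (sq_weight_le_one hG hU hr) v, Real.sqrt_mul (sq_nonneg _),
    Real.sqrt_sq (hnonneg v), ← Complex.ofReal_mul, mul_ite, mul_zero]
  simp only [hht v, add_left_inj]

lemma pow_map_levelVec (n : ℕ) (m : ℤ) :
    (U ^ n) (levelVec hG hU hht m) = levelVec hG hU hht (m + n) := by
  induction n with
  | zero => simp
  | succ n ih =>
    rw [pow_succ', Nat.cast_succ, ← add_assoc, ← map_levelVec hG hU hht hnonneg, ← ih]
    rfl

lemma levelVec_mem_unitaryPart (m : ℤ) : levelVec hG hU hht m ∈ unitaryPart U :=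
  mem_unitaryPart.2 fun n => ⟨levelVec hG hU hht (m - n), by
    rw [pow_map_levelVec hG hU hht hnonneg, sub_add_cancel]⟩

lemma norm_levelVec (m : ℤ) : ‖levelVec hG hU hht m‖ = ‖levelVec hG hU hht 0‖ := by
  induction m with
  | zero => rfl
  | succ i ih => rw [← map_levelVec hG hU hht hnonneg, U.norm_map, ih]
  | pred i ih => rw [← ih, ← U.norm_map, map_levelVec hG hU hht hnonneg, sub_add_cancel]

lemma sqrt_pathProd_mul_inner_levelVec {f : Ell2 V} (hf : f ∈ unitaryPart U) (v : V) :
    (√(pathProd G lam v) : ℂ) * inner ℂ (levelVec hG hU hht (ht v)) f =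
      ((‖levelVec hG hU hht 0‖ ^ 2 : ℝ) : ℂ) * f v := by
  have hnorm : HasSum (fun w => ((‖levelVec hG hU hht (ht v) w‖ ^ 2 : ℝ) : ℂ) * f v)
      (((‖levelVec hG hU hht 0‖ ^ 2 : ℝ) : ℂ) * f v) := by
    rw [← norm_levelVec hG hU hht hnonneg (ht v)]
    exact (Complex.hasSum_ofReal.2 (hasSum_norm_sq (levelVec hG hU hht (ht v)))).mul_right (f v)
  have hinner : HasSum
      (fun w => (√(pathProd G lam v) : ℂ) * inner ℂ (levelVec hG hU hht (ht v) w) (f w))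
      ((√(pathProd G lam v) : ℂ) * inner ℂ (levelVec hG hU hht (ht v)) f) :=
    (lp.hasSum_inner (𝕜 := ℂ) (levelVec hG hU hht (ht v)) f).mul_left (√(pathProd G lam v) : ℂ)
  refine hinner.unique (hnorm.congr_fun fun w => ?_)
  rw [RCLike.inner_apply, levelVec_apply, Complex.norm_real, Real.norm_eq_abs, sq_abs,
    Complex.conj_ofReal]
  split_ifs with h
  · have hcomm := sqrt_pathProd_mul_apply_comm hG hU hht hnonneg hf h
    push_cast
    linear_combination (√(pathProd G lam w) : ℂ) * hcomm
  · simp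

lemma exists_hilbertBasis_unitaryPart {u : V} (hu : pathProd G lam u ≠ 0) :
    ∃ x : HilbertBasis ℤ ℂ (unitaryPart U), ∀ m, U (x m) = x (m + 1) := by
  let y := levelVec hG hU hht
  have hnorm_eq (m : ℤ) : ‖y m‖ = ‖y 0‖ := norm_levelVec hG hU hht hnonneg m
  have hnorm : ‖y 0‖ ≠ 0 := by
    rw [← hnorm_eq (ht u), norm_ne_zero_iff]
    exact mt (pathProd_eq_zero_of_levelVec_eq_zero hG hU hht) hu
  let x (m : ℤ) : unitaryPart U :=
    ⟨((‖y 0‖⁻¹ : ℝ) : ℂ) • y m,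
      Submodule.smul_mem _ _ (levelVec_mem_unitaryPart hG hU hht hnonneg m)⟩
  have hx : Orthonormal ℂ x := by
    refine ⟨fun m => ?_, fun m k hmk => ?_⟩
    · rw [Submodule.coe_norm, norm_smul, hnorm_eq m, Complex.norm_real, norm_inv, norm_norm,
        inv_mul_cancel₀ hnorm]
    · change inner ℂ (((‖y 0‖⁻¹ : ℝ) : ℂ) • y m) (((‖y 0‖⁻¹ : ℝ) : ℂ) • y k) = 0
      rw [inner_smul_left, inner_smul_right, inner_levelVec_of_ne hG hU hht hmk, mul_zero, mul_zero]
  have : CompleteSpace (unitaryPart U) := isClosed_unitaryPart.completeSpace_coe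
  obtain ⟨b, hbx⟩ := exists_hilbertBasis_of_total hx fun f hf => by
    have hyf (m : ℤ) : inner ℂ (y m) (f : Ell2 V) = 0 := by
      have h : inner ℂ (((‖y 0‖⁻¹ : ℝ) : ℂ) • y m) (f : Ell2 V) = 0 := hf m
      simpa [inner_smul_left, hnorm] using h
    refine Subtype.ext (lp.ext (funext fun v => ?_))
    have hv : _ * inner ℂ (y (ht v)) (f : Ell2 V) = ((‖y 0‖ ^ 2 : ℝ) : ℂ) * (f : Ell2 V) v :=
      sqrt_pathProd_mul_inner_levelVec hG hU hht hnonneg f.2 v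
    rw [hyf, mul_zero, eq_comm, mul_eq_zero_iff_left (by simpa using hnorm)] at hv
    exact hv
  refine ⟨b, fun m => ?_⟩
  rw [hbx]
  exact (U.map_smul _ _).trans (congrArg _ (map_levelVec hG hU hht hnonneg m))

lemma unitaryPart_eq_bot_iff : unitaryPart U = ⊥ ↔ ∀ v, pathProd G lam v = 0 := by
  have hr := not_hasRoot_of_height hht
  refine ⟨fun h v => pathProd_eq_zero_of_levelVec_eq_zero hG hU hht ?_,
    fun h => (Submodule.eq_bot_iff _).2 fun f hf => lp.ext (funext fun v => ?_)⟩
  · rw [← Submodule.mem_bot ℂ, ← h]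
    exact levelVec_mem_unitaryPart hG hU hht hnonneg (ht v)
  · have hle := norm_sq_apply_le_of_mem_unitaryPart hG hU hr hf v
    rw [h, zero_mul] at hle
    simpa using hle

end UnitaryPart

section IsometricShift

variable {V : Type*} {G : Digraph V} {lam : V → ℝ} {hb : BoundedWeights G lam}
  {U : Ell2 V →ₗᵢ[ℂ] Ell2 V} (hG : IsDirectedTree G)
  (hU : U.toContinuousLinearMap = weightedShift G lam hb)
include hG hU

theorem unitarilyEquivalent_of_hasRoot (hne : ∀ u v, G.Adj u v → lam v ≠ 0) (hr : HasRoot G) :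
    UnitarilyEquivalent U.toContinuousLinearMap (unilateralShiftMult (branchingIndex G + 1)) := by
  obtain ⟨z⟩ := nonempty_hilbertBasis_wandering hG hU hne
  rw [if_pos hr] at z
  exact unitarilyEquivalent_unilateralShiftMult z (unitaryPart_eq_bot_of_hasRoot hG hU hr)

variable (hr : ¬ HasRoot G)
include hr

lemma nonempty_hilbertBasis_wandering_of_not_hasRoot (hne : ∀ u v, G.Adj u v → lam v ≠ 0) :
    Nonempty (HilbertBasis (IndexSet (branchingIndex G)) ℂ (LinearMap.range U.toLinearMap)ᗮ) := by
  simpa only [if_neg hr, add_zero] using nonempty_hilbertBasis_wandering hG hU hne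

theorem unitarilyEquivalent_of_isCNU (hne : ∀ u v, G.Adj u v → lam v ≠ 0)
    (hcnu : IsCNU U.toContinuousLinearMap) :
    UnitarilyEquivalent U.toContinuousLinearMap (unilateralShiftMult (branchingIndex G)) := by
  obtain ⟨z⟩ := nonempty_hilbertBasis_wandering_of_not_hasRoot hG hU hr hne
  exact unitarilyEquivalent_unilateralShiftMult z (isCNU_iff_unitaryPart_eq_bot.1 hcnu)

variable (hpos : ∀ u v, G.Adj u v → 0 < lam v)
include hpos

omit hG hU in
lemma weight_pos_of_not_hasRoot (v : V) : 0 < lam v :=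
  hpos _ _ (adj_par_of_not_isRoot (not_isRoot_of_not_hasRoot hr v))

theorem isCNU_iff_forall_pathProd_eq_zero :
    IsCNU U.toContinuousLinearMap ↔ ∀ v, pathProd G lam v = 0 := by
  obtain ⟨ht, hht⟩ := hG.exists_height hr
  exact isCNU_iff_unitaryPart_eq_bot.trans
    (unitaryPart_eq_bot_iff hG hU hht fun v => (weight_pos_of_not_hasRoot hr hpos v).le)

theorem isCNU_iff_hasSum_gen_pathProd (u : V) :
    IsCNU U.toContinuousLinearMap ↔ HasSum (fun v : gen G u => pathProd G lam v) 0 :=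
  (isCNU_iff_forall_pathProd_eq_zero hG hU hr hpos).trans
    (hasSum_gen_pathProd_zero_iff (sq_weight_le_one hG hU hr) hG
      (fun v => (weight_pos_of_not_hasRoot hr hpos v).ne') u).symm

theorem unitarilyEquivalent_of_not_isCNU (hcnu : ¬ IsCNU U.toContinuousLinearMap) :
    UnitarilyEquivalent U.toContinuousLinearMap
      (orthSum bilateralShift.toContinuousLinearMap (unilateralShiftMult (branchingIndex G))) := by
  obtain ⟨u, hu⟩ := not_forall.1 (mt (isCNU_iff_forall_pathProd_eq_zero hG hU hr hpos).2 hcnu)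
  obtain ⟨ht, hht⟩ := hG.exists_height hr
  obtain ⟨x, hx⟩ := exists_hilbertBasis_unitaryPart hG hU hht
    (fun v => (weight_pos_of_not_hasRoot hr hpos v).le) hu
  obtain ⟨z⟩ := nonempty_hilbertBasis_wandering_of_not_hasRoot hG hU hr
    fun u v h => (hpos u v h).ne'
  exact unitarilyEquivalent_orthSum_bilateralShift z x hx

end IsometricShift

lemma exists_isometricShift_unitarilyEquivalent {V : Type*} {G : Digraph V} {lam : V → ℝ}
    {hb : BoundedWeights G lam} (hG : IsDirectedTree G) (hc : ‖weightedShift G lam hb‖ ≤ 1)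
    (hne : ∀ u v, G.Adj u v → lam v ≠ 0)
    (hβ : BoundedWeights (coreTree G lam hb) (coreWeight G lam hb)) :
    ∃ U : Ell2 (coreSet G lam hb) →ₗᵢ[ℂ] Ell2 (coreSet G lam hb),
      U.toContinuousLinearMap = weightedShift (coreTree G lam hb) (coreWeight G lam hb) hβ ∧
      UnitarilyEquivalent (isometricAsymptote (weightedShift G lam hb) hc).toContinuousLinearMap
        U.toContinuousLinearMap := by
  let J := coreEquiv hG hc
  refine ⟨J.symm.toLinearIsometry.comp
    ((isometricAsymptote (weightedShift G lam hb) hc).comp J.toLinearIsometry),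
    ContinuousLinearMap.ext fun f => J.injective ?_, J.symm, fun f => ?_⟩
  · rw [← isometricAsymptote_coreEquiv hG hc hne hβ]
    exact J.apply_symm_apply _
  · exact congrArg (fun g => J.symm (isometricAsymptote (weightedShift G lam hb) hc g))
      (J.apply_symm_apply f).symm

end TreeShift

theorem mainTheorem1 {V : Type*} (G : Digraph V) (hG : IsDirectedTree G)
    (lam : V → ℝ) (hpos : ∀ u v, G.Adj u v → 0 < lam v) (hb : BoundedWeights G lam)
    (hc : ‖weightedShift G lam hb‖ ≤ 1) (hns : ¬ IsStable (weightedShift G lam hb)) :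
    -- `V'` is the set of vertices with `H₀ = ℓ²(V \ V')` and `H₀ᗮ = ℓ²(V')`
    stableSubspace (weightedShift G lam hb) = ell2Sub (coreSet G lam hb)ᶜ ∧
    (stableSubspace (weightedShift G lam hb))ᗮ = ell2Sub (coreSet G lam hb) ∧
    -- `T'` is a leafless subtree
    IsDirectedTree (coreTree G lam hb) ∧ IsLeafless (coreTree G lam hb) ∧
    -- the numbers `alpha u` are well defined, and positive on `V'` and at the parents of its vertices
    (∀ u, (∀ n, Summable fun v : chiPow G n u =>
        ∏ j ∈ Finset.range n, lam ((par G)^[j] v) ^ 2) ∧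
      Tendsto (fun n => alphaSum G lam n u) atTop (𝓝 (alpha G lam u))) ∧
    (∀ v ∈ coreSet G lam hb, 0 < alpha G lam v ∧ par G v ∈ coreSet G lam hb) ∧
    -- `U` is the weighted shift on `T'` with the weights `β`
    (∃ hβ : BoundedWeights (coreTree G lam hb) (coreWeight G lam hb),
      ∃ J : Ell2 (coreSet G lam hb) ≃ₗᵢ[ℂ] (stableSubspace (weightedShift G lam hb))ᗮ,
        (∀ f, (J f : Ell2 V) = ell2Incl (coreSet G lam hb) f) ∧
        ∀ f, isometricAsymptote (weightedShift G lam hb) hc (J f) =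
          J (weightedShift (coreTree G lam hb) (coreWeight G lam hb) hβ f)) ∧
    -- (i)
    (HasRoot G →
      UnitarilyEquivalent
        (isometricAsymptote (weightedShift G lam hb) hc).toContinuousLinearMap
        (unilateralShiftMult (branchingIndex (coreTree G lam hb) + 1))) ∧
    -- the description of the completely non-unitary case
    (¬ HasRoot G →
      (IsCNU (isometricAsymptote (weightedShift G lam hb) hc).toContinuousLinearMap ↔
        ∃ u, HasSum (fun v : gen (coreTree G lam hb) u =>
          ∏' j : ℕ, coreWeight G lam hb ((par (coreTree G lam hb))^[j] v) ^ 2) 0) ∧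
      (IsCNU (isometricAsymptote (weightedShift G lam hb) hc).toContinuousLinearMap ↔
        ∀ u, HasSum (fun v : gen (coreTree G lam hb) u =>
          ∏' j : ℕ, coreWeight G lam hb ((par (coreTree G lam hb))^[j] v) ^ 2) 0)) ∧
    -- (ii)
    (¬ HasRoot G →
      IsCNU (isometricAsymptote (weightedShift G lam hb) hc).toContinuousLinearMap →
      UnitarilyEquivalent
        (isometricAsymptote (weightedShift G lam hb) hc).toContinuousLinearMap
        (unilateralShiftMult (branchingIndex (coreTree G lam hb)))) ∧
    -- (iii)
    (¬ HasRoot G →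
      ¬ IsCNU (isometricAsymptote (weightedShift G lam hb) hc).toContinuousLinearMap →
      UnitarilyEquivalent
        (isometricAsymptote (weightedShift G lam hb) hc).toContinuousLinearMap
        (orthSum bilateralShift.toContinuousLinearMap
          (unilateralShiftMult (branchingIndex (coreTree G lam hb))))) := by
  have hne : ∀ u v, G.Adj u v → lam v ≠ 0 := fun u v h => (hpos u v h).ne'
  have hβpos := coreWeight_pos hG hc hpos
  have hβne := fun u v h => (hβpos u v h).ne'
  have hT := isDirectedTree_coreTree hG hc hne
  have hβ := boundedWeights_of_hasSum_one (hasSum_coreWeight_sq hG hc)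
  have hcore := coreSet_nonempty hG hc hns
  have : Nonempty (coreSet G lam hb) := hcore.to_subtype
  have hroot : HasRoot (coreTree G lam hb) ↔ HasRoot G :=
    hG.hasRoot_inducedGraph_iff (mapsTo_par_coreSet hG hc hne) hcore
  obtain ⟨U, hU, hequiv⟩ := exists_isometricShift_unitarilyEquivalent hG hc hne hβ
  refine ⟨stableSubspace_eq hG hc, stableSubspace_orthogonal_eq hG hc, hT,
    isLeafless_of_hasSum_one (hasSum_coreWeight_sq hG hc),
    fun u => ⟨fun n => (hasSum_alphaSum hG hb n u).summable, tendsto_alphaSum hG hc u⟩,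
    fun v hv => ⟨(mem_coreSet_iff hG hc).1 hv, mapsTo_par_coreSet hG hc hne hv⟩,
    ⟨hβ, coreEquiv hG hc, coe_coreEquiv hG hc, isometricAsymptote_coreEquiv hG hc hne hβ⟩,
    fun hr => hequiv.trans (unitarilyEquivalent_of_hasRoot hT hU hβne (hroot.2 hr)), ?_, ?_, ?_⟩
    <;> simp only [hequiv.isCNU_iff] <;> rw [← hroot] <;> intro hr
  · have hiff := isCNU_iff_hasSum_gen_pathProd hT hU hr hβpos
    exact ⟨(exists_const _).symm.trans (exists_congr hiff),
      (forall_const _).symm.trans (forall_congr' hiff)⟩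
  · exact fun h => hequiv.trans (unitarilyEquivalent_of_isCNU hT hU hr hβne h)
  · exact fun h => hequiv.trans (unitarilyEquivalent_of_not_isCNU hT hU hr hβpos h)
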